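/- Let $d\ge 2$, $h>1$ and $\max\{\tfrac{d(h-1)}{2},2\}<q<\infty$, and let $\mathbb T^d=(\mathbb R/\mathbb Z)^d$. There is a number $\xi_0\in(q,\infty)$ depending only on $(q,h,d)$ such that the following holds whenever either $d\ge 3$ and $\xi=\frac{dq}{d-2}$, or $d=2$ and $\xi\in[\xi_0,\infty)$. Let $\ell\ge 1$, $\mu_1,\dots,\mu_\ell>0$, and let $f_i:(0,\infty)\times\mathbb T^d\times\mathbb R^\ell\to\mathbb R$ and $F_i:(0,\infty)\times\mathbb T^d\times\mathbb R^\ell\to\mathbb R^d$ ($1\le i\le\ell$) be Borel measurable maps such that: (i) (polynomial growth) there is $C$ such that, for a.e. $(t,x)\in(0,\infty)\times\mathbb T^d$ and all $i$ and $y,y'\in\mathbb R^\ell$, $|f_i(t,x,y)|\le C(1+|y|^h)$, $|F_i(t,x,y)|\le C(1+|y|^{\frac{h+1}{2}})$, $|f_i(t,x,y)-f_i(t,x,y')|\le C(1+|y|^{h-1}+|y'|^{h-1})|y-y'|$ and $|F_i(t,x,y)-F_i(t,x,y')|\le C(1+|y|^{\frac{h-1}{2}}+|y'|^{\frac{h-1}{2}})|y-y'|$;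 (ii) (positivity) there are measurable $c_i:(0,\infty)\to\mathbb R^d$ such that, for a.e. $(t,x)$, all $i$ and all $y\in[0,\infty)^\ell$ with $y_i=0$, $f_i(t,x,y)\ge 0$ and $F_i(t,x,y)=c_i(t)$; (iii) (mass control) there are $\alpha_1,\dots,\alpha_\ell>0$ and $a_0,a_1\in\mathbb R$ such that $\sum_i\alpha_i f_i(t,x,y)\le a_0+a_1\sum_i y_i$ for all $t>0$, $x\in\mathbb T^d$, $y\in[0,\infty)^\ell$. Let $T\in(0,\infty)$, $\gamma\in(0,1)$, $v_0\in L^q(\mathbb T^d;\mathbb R^\ell)$, and set (all spaces being spaces of $\mathbb R^\ell$-valued maps on $\mathbb T^d$) $$\mathcal X=L^2(0,T;H^{1-\gamma})\cap C([0,T];H^{-\gamma})\cap L^\infty(0,T;L^q)\cap L^q(0,T;L^\xi).$$ Let $v^{(1)},v^{(2)}\in\mathcal X$ be weak solutions of $$\partial_t v_i=\mu_i\Delta v_i+\operatorname{div}(F_i(\cdot,v))+f_i(\cdot,v),\qquad v_i(0)=v_{0,i},\qquad 1\le i\le \ell,$$ i.e. for $j\in\{1,2\}$, all $\eta\in C^\infty(\mathbb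 T^d;\mathbb R^\ell)$ and all $t\in[0,T]$, $$\langle v^{(j)}(t),\eta\rangle=\int_{\mathbb T^d}v_0\cdot\eta\,dx+\sum_{i=1}^{\ell}\int_0^t\!\!\int_{\mathbb T^d}\Big(\mu_i v^{(j)}_i\Delta\eta_i+f_i(\cdot,v^{(j)})\eta_i-F_i(\cdot,v^{(j)})\cdot\nabla\eta_i\Big)dx\,ds,$$ where $\langle\cdot,\cdot\rangle$ is the $H^{-\gamma}\times H^{\gamma}$ duality pairing. Then $v^{(1)}\equiv v^{(2)}$: $v^{(1)}(t)=v^{(2)}(t)$ in $H^{-\gamma}$ for every $t\in[0,T]$, and $v^{(1)}=v^{(2)}$ a.e. on $(0,T)\times\mathbb T^d$. -/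

import Mathlib

open MeasureTheory Set Filter Topology
open scoped ENNReal

noncomputable section

namespace ReactionDiffusion

/-- The flat torus `(ℝ / ℤ)^d`, with its normalised Haar measure as `volume`. -/
abbrev Torus (d : ℕ) : Type := UnitAddTorus (Fin d)

/-- `ℝ^n` with the Euclidean norm. -/
abbrev Vec (n : ℕ) : Type := EuclideanSpace ℝ (Fin n)

/-! ### Calculus on the torus -/

/-- The partial derivative in the direction of the `j`-th coordinate. -/
def partialDeriv {d : ℕ} (j : Fin d) (g : Torus d → ℝ) (x : Torus d) : ℝ :=
  deriv (fun s : ℝ => g (x + Pi.single j (s : UnitAddCircle))) 0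

def gradient {d : ℕ} (g : Torus d → ℝ) (x : Torus d) : Vec d :=
  WithLp.toLp 2 fun j => partialDeriv j g x

def laplacian {d : ℕ} (g : Torus d → ℝ) (x : Torus d) : ℝ :=
  ∑ j, partialDeriv j (partialDeriv j g) x

/-- `η ∈ C^∞(𝕋^d; ℝ^ℓ)`: the periodic lift of `η` to `ℝ^d` is smooth. -/
def Smooth {d ℓ : ℕ} (η : Torus d → Vec ℓ) : Prop :=
  ContDiff ℝ ((⊤ : ℕ∞) : WithTop ℕ∞) fun y : Fin d → ℝ => η fun j => (y j : UnitAddCircle)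

/-! ### Sobolev spaces on the torus -/

/-- An `ℓ`-component periodic distribution, given by its Fourier coefficients:
`c i k` is the `k`-th Fourier coefficient of the `i`-th component. -/
abbrev FourierFamily (d ℓ : ℕ) : Type := Fin ℓ → (Fin d → ℤ) → ℂ

/-- The Fourier coefficients of an integrable function `g : 𝕋^d → ℝ^ℓ`. -/
def fourierFamily {d ℓ : ℕ} (g : Torus d → Vec ℓ) : FourierFamily d ℓ :=
  fun i k => UnitAddTorus.mFourierCoeff (fun x => ((g x i : ℝ) : ℂ)) k

/-- The squared `H^s` norm `∑_k (1 + |k|²)^s |c_k|²`, with value `∞` outside `H^s`. -/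
def sobolevNormSq {d ℓ : ℕ} (s : ℝ) (c : FourierFamily d ℓ) : ℝ≥0∞ :=
  ∑' k : Fin d → ℤ, ENNReal.ofReal ((1 + ∑ j, (k j : ℝ) ^ 2) ^ s) * ∑ i, ‖c i k‖ₑ ^ 2

/-- `c ∈ H^s(𝕋^d; ℝ^ℓ)`: finite norm, and real-valued. -/
def MemSobolev {d ℓ : ℕ} (s : ℝ) (c : FourierFamily d ℓ) : Prop :=
  sobolevNormSq s c < ⊤ ∧ ∀ i k, c i (-k) = star (c i k)

/-- The duality pairing of `c ∈ H^{-γ}(𝕋^d; ℝ^ℓ)` with `η ∈ H^γ(𝕋^d; ℝ^ℓ)`. It extends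
`∫ c · η dx` and is an absolutely convergent sum on `H^{-γ} × H^γ`. -/
def pairing {d ℓ : ℕ} (c : FourierFamily d ℓ) (η : Torus d → Vec ℓ) : ℝ :=
  ∑' k : Fin d → ℤ, ∑ i, (c i k * star (fourierFamily η i k)).re

/-! ### The nonlinearities -/

/-- Borel measurability, polynomial growth and local Lipschitz continuity of `f_i` and `F_i`,
with exponent `h`. -/
structure PolynomialGrowth {d ℓ : ℕ} (h : ℝ) (f : Fin ℓ → ℝ → Torus d → Vec ℓ → ℝ)
    (F : Fin ℓ → ℝ → Torus d → Vec ℓ → Vec d) : Prop where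
  measurable_f : ∀ i, Measurable fun p : Ioi (0 : ℝ) × Torus d × Vec ℓ => f i p.1 p.2.1 p.2.2
  measurable_F : ∀ i, Measurable fun p : Ioi (0 : ℝ) × Torus d × Vec ℓ => F i p.1 p.2.1 p.2.2
  growth : ∃ C : ℝ, ∀ᵐ p : ℝ × Torus d ∂((volume.restrict (Ioi (0 : ℝ))).prod volume),
    ∀ (i : Fin ℓ) (y y' : Vec ℓ),
      |f i p.1 p.2 y| ≤ C * (1 + ‖y‖ ^ h) ∧
      ‖F i p.1 p.2 y‖ ≤ C * (1 + ‖y‖ ^ ((h + 1) / 2)) ∧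
      |f i p.1 p.2 y - f i p.1 p.2 y'| ≤ C * (1 + ‖y‖ ^ (h - 1) + ‖y'‖ ^ (h - 1)) * ‖y - y'‖ ∧
      ‖F i p.1 p.2 y - F i p.1 p.2 y'‖ ≤
        C * (1 + ‖y‖ ^ ((h - 1) / 2) + ‖y'‖ ^ ((h - 1) / 2)) * ‖y - y'‖

/-- For nonnegative `y` with `y_i = 0`: `f_i ≥ 0`, and `F_i` depends on time only. -/
def Positivity {d ℓ : ℕ} (f : Fin ℓ → ℝ → Torus d → Vec ℓ → ℝ)
    (F : Fin ℓ → ℝ → Torus d → Vec ℓ → Vec d) : Prop :=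
  ∃ c : Fin ℓ → ℝ → Vec d, (∀ i, Measurable fun t : Ioi (0 : ℝ) => c i t) ∧
    ∀ᵐ p : ℝ × Torus d ∂((volume.restrict (Ioi (0 : ℝ))).prod volume),
      ∀ (i : Fin ℓ) (y : Vec ℓ), (∀ j, 0 ≤ y j) → y i = 0 →
        0 ≤ f i p.1 p.2 y ∧ F i p.1 p.2 y = c i p.1

/-- Control of the weighted total mass production. -/
def MassControl {d ℓ : ℕ} (f : Fin ℓ → ℝ → Torus d → Vec ℓ → ℝ) : Prop :=
  ∃ (α : Fin ℓ → ℝ) (a₀ a₁ : ℝ), (∀ i, 0 < α i) ∧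
    ∀ (t : ℝ), 0 < t → ∀ (x : Torus d) (y : Vec ℓ), (∀ j, 0 ≤ y j) →
      ∑ i, α i * f i t x y ≤ a₀ + a₁ * ∑ i, y i

/-! ### Solution class and weak solutions -/

/-- `v ∈ L²(0,T;H^{1-γ}) ∩ C([0,T];H^{-γ}) ∩ L^∞(0,T;L^q) ∩ L^q(0,T;L^ξ)`. Here `v` is the
continuous path in `H^{-γ}`, and `u` is a jointly measurable function on `(0,T) × 𝕋^d`
such that the distribution `v t` is the function `u t` for almost every `t`. -/
structure MemClass {d ℓ : ℕ} (T γ q ξ : ℝ) (v : ℝ → FourierFamily d ℓ)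
    (u : ℝ → Torus d → Vec ℓ) : Prop where
  mem_neg : ∀ t ∈ Icc 0 T, MemSobolev (-γ) (v t)
  continuous_neg : ∀ t₀ ∈ Icc 0 T,
    Tendsto (fun t => sobolevNormSq (-γ) (v t - v t₀)) (𝓝[Icc 0 T] t₀) (𝓝 0)
  sobolev_bound : ∫⁻ t in Ioo 0 T, sobolevNormSq (1 - γ) (v t) < ⊤
  measurable : AEStronglyMeasurable (fun p : ℝ × Torus d => u p.1 p.2)
    ((volume.restrict (Ioo 0 T)).prod volume)
  represents : ∀ᵐ t ∂(volume.restrict (Ioo 0 T)),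
    Integrable (u t) volume ∧ fourierFamily (u t) = v t
  sup_bound :
    essSup (fun t => eLpNorm (u t) (ENNReal.ofReal q) volume) (volume.restrict (Ioo 0 T)) < ⊤
  integral_bound : ∫⁻ t in Ioo 0 T, eLpNorm (u t) (ENNReal.ofReal ξ) volume ^ q < ⊤

/-- The weak formulation on `[0,T]` of
`∂_t v_i = μ_i Δ v_i + div (F_i(·,v)) + f_i(·,v)`, `v(0) = v₀`. -/
def IsWeakSolution {d ℓ : ℕ} (T : ℝ) (μ : Fin ℓ → ℝ) (f : Fin ℓ → ℝ → Torus d → Vec ℓ → ℝ)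
    (F : Fin ℓ → ℝ → Torus d → Vec ℓ → Vec d) (v₀ : Torus d → Vec ℓ)
    (v : ℝ → FourierFamily d ℓ) (u : ℝ → Torus d → Vec ℓ) : Prop :=
  ∀ η : Torus d → Vec ℓ, Smooth η → ∀ t ∈ Icc 0 T,
    pairing (v t) η = (∫ x, inner ℝ (v₀ x) (η x)) +
      ∑ i, ∫ s in (0 : ℝ)..t, ∫ x,
        (μ i * u s x i * laplacian (fun z => η z i) x + f i s x (u s x) * η x i -
          inner ℝ (F i s x (u s x)) (gradient (fun z => η z i) x))

end ReactionDiffusion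

end

namespace ReactionDiffusion

open scoped ComplexConjugate
open UnitAddTorus (mFourier mFourierCoeff)

/-! ### Fourier series on the torus -/

/-! The proof is an energy estimate in `L²` for the difference `w = u₁ - u₂`. By the Lipschitz
bounds, `w` solves `∂ₜw = μΔw + g + div G` with zero initial datum, where `|g| ≲ V|w|`, `|G| ≲
V^{1/2}|w|` and `V = (1 + |u₁| + |u₂|)^{h-1}`. Since the solutions are bounded in time with values
in `L^q`, `V` lies in `L^∞(L^σ)` with `σ = q/(h-1)`, and `q > d(h-1)/2` says exactly that `σ > d/2`.
So `V` is a subcritical potential for the Laplacian.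

A priori `w` is only in `L²(H^{1-γ})`, so the equation cannot be tested with `w` itself. Instead it
is tested with trigonometric monomials. Each Fourier coefficient of `w` is then a primitive of an
`L¹` function of time and satisfies an exact energy identity (`mode_energy`). The sum of these over
all frequencies is `E(t) + m∫H ≤ C∫Q`, with `E = ‖w‖²_{L²}`, `H = ‖w‖²_{H¹}`, `Q = ∫V|w|²`. For this
one needs `‖G‖²_{L²} + ‖g‖²_{H^{-1}} ≲ Q` (`exists_tsum_nonlinearity_le`). The integral of `Q` in
time is finite because `V|w|² ≤ (1 + |u₁| + |u₂|)^{h+1}` and interpolation between `L^∞(L^q)` and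
`L^q(L^ξ)` puts `u₁, u₂` in `L^{h+1}` of space-time (`MemClass.lintegral_rpow_ne_top`). Hence `w ∈
L²(H¹)` is a conclusion, not an assumption. Subcriticality gives `Q ≤ εH + C_ε E`
(`exists_lintegral_mul_enorm_sq_le_small`). The `H` term is absorbed and Grönwall's inequality
(`gronwall_lintegral`) yields `E = 0`.

The two bounds involving `V` take the place of Sobolev embeddings and are proved by hand on the
Fourier side. If `|g|² ≤ VΦ`, splitting `g` at a level of `V` chosen from the number of frequencies
gives `∑_{k∈S} |ĝ(k)|² ≲ |S|^{1/σ} ∫Φ`. Summation over dyadic boxes gives `g ∈ H^{-s}` for `2s >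
d/σ`. Duality turns this into the form bound `∫V|w|² ≲ ‖w‖²_{H^s}`, and since some `s < 1` is
allowed, interpolation makes the `H¹` part small. -/

theorem volume_torus (d : ℕ) :
    (volume : Measure (Torus d)) = Measure.pi fun _ => AddCircle.haarAddCircle := by
  rw [volume_pi]
  congr 1
  ext1 i
  simp [AddCircle.volume_eq_smul_haarAddCircle]

instance isProbabilityMeasure_torus (d : ℕ) :
    IsProbabilityMeasure (volume : Measure (Torus d)) := by
  rw [volume_torus]
  infer_instance

variable {d : ℕ}

theorem mFourierCoeff_eq_integral_mul (g : Torus d → ℂ) (k : Fin d → ℤ) :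
    mFourierCoeff g k = ∫ x, mFourier (-k) x * g x := by
  rw [volume_torus]
  rfl

theorem norm_mFourier_apply (k : Fin d → ℤ) (x : Torus d) : ‖mFourier k x‖ = 1 := by
  simp only [mFourier, ContinuousMap.coe_mk, fourier_apply, norm_prod, Circle.norm_coe,
    Finset.prod_const_one]

theorem integrable_mFourier_mul {g : Torus d → ℂ} (hg : Integrable g) (k : Fin d → ℤ) :
    Integrable fun x => mFourier k x * g x :=
  hg.bdd_mul (mFourier k).continuous.aestronglyMeasurable
    (ae_of_all _ fun x => (norm_mFourier_apply k x).le)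

theorem hasSum_inner_mFourierCoeff {g f : Torus d → ℂ} (hg : MemLp g 2) (hf : MemLp f 2) :
    HasSum (fun k => conj (mFourierCoeff g k) * mFourierCoeff f k)
      (∫ x, conj (g x) * f x) := by
  simp_rw [mFourierCoeff_eq_integral_mul]
  rw [volume_torus] at *
  have := UnitAddTorus.hasSum_prod_mFourierCoeff (hg.toLp g) (hf.toLp f)
  convert this using 1
  · ext k
    congr 1
    · congr 1
      apply integral_congr_ae
      filter_upwards [hg.coeFn_toLp] with x hx
      rw [hx]; rfl
    · apply integral_congr_ae
      filter_upwards [hf.coeFn_toLp] with x hx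
      rw [hx]; rfl
  · apply integral_congr_ae
    filter_upwards [hg.coeFn_toLp, hf.coeFn_toLp] with x hx hx'
    rw [hx, hx']

theorem enorm_sq_eq_ofReal {E : Type*} [SeminormedAddCommGroup E] (z : E) :
    ‖z‖ₑ ^ 2 = ENNReal.ofReal (‖z‖ ^ 2) := by
  rw [ENNReal.ofReal_pow (norm_nonneg _), ofReal_norm]

theorem tsum_enorm_sq_mFourierCoeff {g : Torus d → ℂ} (hg : MemLp g 2) :
    ∑' k, ‖mFourierCoeff g k‖ₑ ^ 2 = ∫⁻ x, ‖g x‖ₑ ^ 2 := by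
  have h := hasSum_inner_mFourierCoeff hg hg
  have h2 : Integrable (fun x => ‖g x‖ ^ 2) volume := hg.integrable_norm_pow (by norm_num)
  have e : ∀ z : ℂ, conj z * z = ((‖z‖ ^ 2 : ℝ) : ℂ) := fun z => by
    rw [Complex.conj_mul', Complex.ofReal_pow]
  simp_rw [e] at h
  rw [integral_complex_ofReal, Complex.hasSum_ofReal] at h
  simp_rw [enorm_sq_eq_ofReal]
  rw [← ofReal_integral_eq_lintegral_ofReal h2 (ae_of_all _ fun x => by positivity), ← h.tsum_eq,
    ENNReal.ofReal_tsum_of_nonneg (fun k => by positivity) h.summable]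

theorem mFourierCoeff_add {g f : Torus d → ℂ} (hg : Integrable g) (hf : Integrable f)
    (k : Fin d → ℤ) : mFourierCoeff (g + f) k = mFourierCoeff g k + mFourierCoeff f k := by
  simp_rw [mFourierCoeff_eq_integral_mul]
  rw [← integral_add (integrable_mFourier_mul hg _) (integrable_mFourier_mul hf _)]
  simp [mul_add]

theorem enorm_mFourierCoeff_le (g : Torus d → ℂ) (k : Fin d → ℤ) :
    ‖mFourierCoeff g k‖ₑ ≤ ∫⁻ x, ‖g x‖ₑ := by
  rw [mFourierCoeff_eq_integral_mul]
  refine (enorm_integral_le_lintegral_enorm _).trans_eq (lintegral_congr fun x => ?_)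
  rw [enorm_mul, ← ofReal_norm (mFourier (-k) x), norm_mFourier_apply]
  simp

theorem enorm_add_sq_le {E : Type*} [SeminormedAddCommGroup E] (x y : E) :
    ‖x + y‖ₑ ^ 2 ≤ 2 * (‖x‖ₑ ^ 2 + ‖y‖ₑ ^ 2) := by
  simp_rw [enorm_sq_eq_ofReal]
  rw [← ENNReal.ofReal_add (by positivity) (by positivity),
    ← ENNReal.ofReal_ofNat 2, ← ENNReal.ofReal_mul (by norm_num)]
  apply ENNReal.ofReal_le_ofReal
  nlinarith [norm_add_le x y, norm_nonneg (x + y), sq_nonneg (‖x‖ - ‖y‖), norm_nonneg x,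
    norm_nonneg y]

/-! ### Products with subcritical potentials in negative Sobolev spaces -/

theorem memLp_two_of_lintegral_ne_top {α : Type*} [MeasurableSpace α] {μ : Measure α} {g : α → ℂ}
    (hg : AEStronglyMeasurable g μ) (h : ∫⁻ x, ‖g x‖ₑ ^ 2 ∂μ ≠ ⊤) : MemLp g 2 μ := by
  refine ⟨hg, ?_⟩
  rw [eLpNorm_lt_top_iff_lintegral_rpow_enorm_lt_top (by norm_num) (by norm_num)]
  simpa using h.lt_top

theorem ennreal_mul_rpow_sub_one (x : ℝ≥0∞) {σ : ℝ} (hσ : 1 ≤ σ) : x * x ^ (σ - 1) = x ^ σ := by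
  conv_lhs => rw [← ENNReal.rpow_one x, ← ENNReal.rpow_mul, one_mul]
  rw [← ENNReal.rpow_add_of_nonneg _ _ zero_le_one (by linarith), add_sub_cancel]

/-- Cut `g` at the level `V = L`. Where `V ≤ L`, `g` is in `L²` with squared norm at most `L∫Φ`, and
Bessel's inequality applies. Where `V > L`, `g` is only in `L¹`, and Cauchy–Schwarz bounds each
coefficient separately, at the price of a factor `|S|`. The choice `L = |S|^{1/σ}` balances the two
contributions. -/
theorem sum_enorm_sq_mFourierCoeff_le_of_measurable {σ : ℝ} (hσ : 1 ≤ σ) {V Φ : Torus d → ℝ≥0∞}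
    (hV : Measurable V) (hΦ : AEMeasurable Φ) {g : Torus d → ℂ} (hg : AEStronglyMeasurable g)
    (hgV : ∀ᵐ x, ‖g x‖ₑ ^ 2 ≤ V x * Φ x) (hVσ : ∫⁻ x, V x ^ σ ≠ ⊤) (hΦi : ∫⁻ x, Φ x ≠ ⊤)
    {S : Finset (Fin d → ℤ)} (hS : S.Nonempty) :
    ∑ k ∈ S, ‖mFourierCoeff g k‖ₑ ^ 2 ≤
      2 * (S.card : ℝ≥0∞) ^ (1 / σ) * (1 + ∫⁻ x, V x ^ σ) * ∫⁻ x, Φ x := by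
  set L : ℝ≥0∞ := (S.card : ℝ≥0∞) ^ (1 / σ) with hL
  have hσ0 : 0 < σ := by linarith
  have hcard1 : (1 : ℝ≥0∞) ≤ S.card := by exact_mod_cast hS.card_pos
  have hL1 : 1 ≤ L := ENNReal.one_le_rpow hcard1 (by positivity)
  have hLtop : L ≠ ⊤ := ENNReal.rpow_ne_top_of_nonneg (by positivity) (by simp)
  -- `L^σ = |S|`, written so that the factor `|S|` from the high part can be traded for `L` times
  -- the Chebyshev gain `L^{σ-1}` of `h3`.
  have hLσ : L * L ^ (σ - 1) = S.card := by
    rw [ennreal_mul_rpow_sub_one _ hσ, hL, ← ENNReal.rpow_mul,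
      one_div_mul_cancel hσ0.ne', ENNReal.rpow_one]
  set A : Set (Torus d) := {x | V x ≤ L}
  have hA : MeasurableSet A := measurableSet_le hV measurable_const
  have h1 : ∫⁻ x, ‖A.indicator g x‖ₑ ^ 2 ≤ L * ∫⁻ x, Φ x := by
    rw [← lintegral_const_mul'' _ hΦ]
    apply lintegral_mono_ae
    filter_upwards [hgV] with x hx
    by_cases hxA : x ∈ A
    · simp only [hxA, indicator_of_mem]
      exact hx.trans (by gcongr; exact hxA)
    · simp [hxA]
  have h2 : (∫⁻ x, ‖Aᶜ.indicator g x‖ₑ) ^ 2 ≤ (∫⁻ x in Aᶜ, V x) * ∫⁻ x, Φ x := by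
    have : ∫⁻ x, ‖Aᶜ.indicator g x‖ₑ ≤ (∫⁻ x in Aᶜ, V x) ^ (1 / 2 : ℝ)
        * (∫⁻ x in Aᶜ, Φ x) ^ (1 / 2 : ℝ) := by
      refine le_trans ?_ (ENNReal.lintegral_mul_norm_pow_le hV.aemeasurable hΦ.restrict
        (by norm_num) (by norm_num) (by norm_num))
      simp_rw [enorm_indicator_eq_indicator_enorm]
      rw [lintegral_indicator hA.compl]
      apply lintegral_mono_ae
      filter_upwards [ae_restrict_of_ae hgV] with x hx
      rw [← ENNReal.mul_rpow_of_nonneg _ _ (by norm_num), one_div,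
        ENNReal.le_rpow_inv_iff (by norm_num)]
      exact_mod_cast hx
    calc _ ≤ ((∫⁻ x in Aᶜ, V x) ^ (1 / 2 : ℝ) * (∫⁻ x in Aᶜ, Φ x) ^ (1 / 2 : ℝ)) ^ 2 := by gcongr
      _ = (∫⁻ x in Aᶜ, V x) * ∫⁻ x in Aᶜ, Φ x := by
        rw [mul_pow, ← ENNReal.rpow_natCast, ← ENNReal.rpow_natCast, ← ENNReal.rpow_mul,
          ← ENNReal.rpow_mul]
        norm_num
      _ ≤ _ := by gcongr; exact Measure.restrict_le_self
  -- Chebyshev: on the set `V > L` one has `L^{σ-1} V ≤ V^σ`.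
  have h3 : L ^ (σ - 1) * ∫⁻ x in Aᶜ, V x ≤ ∫⁻ x, V x ^ σ := by
    rw [← lintegral_const_mul _ hV]
    refine le_trans ?_ (setLIntegral_le_lintegral Aᶜ _)
    apply setLIntegral_mono' hA.compl
    intro x hx
    have hx : L < V x := not_le.1 hx
    calc L ^ (σ - 1) * V x ≤ V x ^ (σ - 1) * V x := by
          gcongr
      _ = V x ^ σ := by rw [mul_comm, ennreal_mul_rpow_sub_one _ hσ]
  have hL0 : L ^ (σ - 1) ≠ 0 := (ENNReal.rpow_pos (by positivity) hLtop).ne'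
  have h3' : ∫⁻ x in Aᶜ, V x ≠ ⊤ := by
    intro h
    rw [h, ENNReal.mul_top hL0] at h3
    exact hVσ (top_le_iff.1 h3)
  have i1 : MemLp (A.indicator g) 2 :=
    memLp_two_of_lintegral_ne_top (hg.indicator hA) (h1.trans_lt (by finiteness)).ne
  have i2 : Integrable (Aᶜ.indicator g) := by
    refine ⟨hg.indicator hA.compl, ?_⟩
    have : (∫⁻ x, ‖Aᶜ.indicator g x‖ₑ) ^ 2 < ⊤ := h2.trans_lt (by finiteness)
    rw [hasFiniteIntegral_iff_enorm]
    simpa using this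
  have hsplit : g = A.indicator g + Aᶜ.indicator g := (indicator_self_add_compl A g).symm
  calc ∑ k ∈ S, ‖mFourierCoeff g k‖ₑ ^ 2
      ≤ ∑ k ∈ S, 2 * (‖mFourierCoeff (A.indicator g) k‖ₑ ^ 2
          + (∫⁻ x in Aᶜ, V x) * ∫⁻ x, Φ x) := by
        apply Finset.sum_le_sum
        intro k _
        conv_lhs => rw [hsplit, mFourierCoeff_add (i1.integrable (by norm_num)) i2]
        refine (enorm_add_sq_le _ _).trans ?_
        gcongr
        exact le_trans (by gcongr; exact enorm_mFourierCoeff_le _ _) h2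
    _ = 2 * (∑ k ∈ S, ‖mFourierCoeff (A.indicator g) k‖ₑ ^ 2
          + L * (L ^ (σ - 1) * ∫⁻ x in Aᶜ, V x) * ∫⁻ x, Φ x) := by
        rw [← Finset.mul_sum, Finset.sum_add_distrib, Finset.sum_const, nsmul_eq_mul, ← hLσ]
        ring
    _ ≤ 2 * (L * (∫⁻ x, Φ x) + L * (∫⁻ x, V x ^ σ) * ∫⁻ x, Φ x) := by
        gcongr
        refine (ENNReal.sum_le_tsum _).trans ?_
        rwa [tsum_enorm_sq_mFourierCoeff i1]
    _ = _ := by ring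

theorem sum_enorm_sq_mFourierCoeff_le {σ : ℝ} (hσ : 1 ≤ σ) {V Φ : Torus d → ℝ≥0∞}
    (hV : AEMeasurable V) (hΦ : AEMeasurable Φ) {g : Torus d → ℂ} (hg : AEStronglyMeasurable g)
    (hgV : ∀ᵐ x, ‖g x‖ₑ ^ 2 ≤ V x * Φ x) (hVσ : ∫⁻ x, V x ^ σ ≠ ⊤) (hΦi : ∫⁻ x, Φ x ≠ ⊤)
    {S : Finset (Fin d → ℤ)} (hS : S.Nonempty) :
    ∑ k ∈ S, ‖mFourierCoeff g k‖ₑ ^ 2 ≤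
      2 * (S.card : ℝ≥0∞) ^ (1 / σ) * (1 + ∫⁻ x, V x ^ σ) * ∫⁻ x, Φ x := by
  have e : ∫⁻ x, V x ^ σ = ∫⁻ x, hV.mk V x ^ σ :=
    lintegral_congr_ae (hV.ae_eq_mk.mono fun x hx => by simp only [hx])
  rw [e] at hVσ ⊢
  refine sum_enorm_sq_mFourierCoeff_le_of_measurable hσ hV.measurable_mk hΦ hg ?_ hVσ hΦi hS
  filter_upwards [hgV, hV.ae_eq_mk] with x h1 h2
  rwa [← h2]

/-- The Japanese bracket `⟨k⟩² = 1 + |k|²`. -/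
def bracketSq (k : Fin d → ℤ) : ℝ := 1 + ∑ j, (k j : ℝ) ^ 2

theorem one_le_bracketSq (k : Fin d → ℤ) : 1 ≤ bracketSq k :=
  le_add_of_nonneg_right (Finset.sum_nonneg fun _ _ => sq_nonneg _)

/-- Take the least `j` with all `|k i| ≤ 2^j`. If `j > 0`, minimality gives a component larger than
`2^{j-1}`, so `⟨k⟩² ≥ 4^{j-1}`. The shift by one is the source of the factor `4^s`. -/
theorem exists_dyadic_box {s : ℝ} (hs : 0 ≤ s) (k : Fin d → ℤ) :
    ∃ j : ℕ, k ∈ Fintype.piFinset (fun _ : Fin d => Finset.Icc (-(2 ^ j : ℤ)) (2 ^ j)) ∧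
      bracketSq k ^ (-s) ≤ 4 ^ s * (2 : ℝ) ^ (-(2 * s) * j) := by
  have hex : ∃ j : ℕ, ∀ i, |k i| ≤ (2 ^ j : ℤ) := by
    refine ⟨∑ i, (k i).natAbs, fun i => ?_⟩
    have h1 : (k i).natAbs ≤ ∑ i, (k i).natAbs :=
      Finset.single_le_sum (f := fun i => (k i).natAbs) (fun _ _ => Nat.zero_le _)
        (Finset.mem_univ i)
    have h2 := (Nat.lt_two_pow_self (n := ∑ i, (k i).natAbs)).le
    rw [← Int.natCast_natAbs]
    exact_mod_cast h1.trans h2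
  classical
  refine ⟨Nat.find hex, ?_, ?_⟩
  · rw [Fintype.mem_piFinset]
    intro i
    rw [Finset.mem_Icc]
    exact abs_le.1 (Nat.find_spec hex i)
  rcases h0 : Nat.find hex with _ | j
  · simp only [Nat.cast_zero, mul_zero, Real.rpow_zero, mul_one]
    exact (Real.rpow_le_one_of_one_le_of_nonpos (one_le_bracketSq k) (by linarith)).trans
      (Real.one_le_rpow (by norm_num) hs)
  · have hj := Nat.find_min hex (m := j) (by omega)
    push Not at hj
    obtain ⟨i, hi⟩ := hj
    have h4 : (4 : ℝ) ^ j ≤ bracketSq k := by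
      have h5 : ((2 : ℝ) ^ j) ≤ |(k i : ℝ)| := by exact_mod_cast hi.le
      have h6 : (4 : ℝ) ^ j = (2 ^ j) ^ 2 := by rw [← pow_mul, mul_comm, pow_mul]; norm_num
      have h7 : (k i : ℝ) ^ 2 ≤ ∑ j, (k j : ℝ) ^ 2 :=
        Finset.single_le_sum (f := fun j => (k j : ℝ) ^ 2) (fun _ _ => sq_nonneg _)
          (Finset.mem_univ i)
      rw [h6, bracketSq]
      have := pow_le_pow_left₀ (by positivity) h5 2
      rw [sq_abs] at this
      linarith
    calc bracketSq k ^ (-s) ≤ ((4 : ℝ) ^ j) ^ (-s) :=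
          Real.rpow_le_rpow_of_nonpos (by positivity) h4 (by linarith)
      _ = 4 ^ s * (2 : ℝ) ^ (-(2 * s) * ((j + 1 : ℕ) : ℝ)) := by
          have : (4 : ℝ) = 2 ^ (2 : ℝ) := by norm_num
          rw [← Real.rpow_natCast, this, ← Real.rpow_mul (by norm_num),
            ← Real.rpow_mul (by norm_num), ← Real.rpow_mul (by norm_num),
            ← Real.rpow_add (by norm_num)]
          push_cast
          ring_nf

/-- A sequence whose sums over cubes of side `R` are `O(R^{d/σ})` has finite sum against
`⟨k⟩^{-2s}` as soon as `2s > d/σ`. -/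
theorem exists_tsum_bracketSq_rpow_neg_mul_le (d : ℕ) {σ s : ℝ} (hσ : 0 < σ)
    (hs : d / σ < 2 * s) : ∃ K : ℝ≥0∞, K ≠ ⊤ ∧ ∀ (b : (Fin d → ℤ) → ℝ≥0∞) (B : ℝ≥0∞),
      (∀ S : Finset (Fin d → ℤ), S.Nonempty → ∑ k ∈ S, b k ≤ B * (S.card : ℝ≥0∞) ^ (1 / σ)) →
      ∑' k, ENNReal.ofReal (bracketSq k ^ (-s)) * b k ≤ K * B := by
  have hs0 : 0 ≤ s := by
    have : 0 ≤ d / σ := by positivity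
    linarith
  -- Ratio of the geometric series over dyadic boxes: the `j`-th box has at most `(3·2^j)^d` points,
  -- contributing `2^{jd/σ}`, against the weight `2^{-2sj}`.
  set r : ℝ := 2 ^ (d / σ - 2 * s) with hr
  have hr1 : r < 1 := Real.rpow_lt_one_of_one_lt_of_neg (by norm_num) (by linarith)
  have hr0 : 0 ≤ r := by positivity
  refine ⟨∑' j : ℕ, ENNReal.ofReal (4 ^ s * 3 ^ (d / σ) * r ^ j), ?_, fun b B hb => ?_⟩
  · rw [← ENNReal.ofReal_tsum_of_nonneg (fun j => by positivity)
      ((summable_geometric_of_lt_one hr0 hr1).mul_left _)]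
    exact ENNReal.ofReal_ne_top
  set box : ℕ → Finset (Fin d → ℤ) := fun j =>
    Fintype.piFinset (fun _ : Fin d => Finset.Icc (-(2 ^ j : ℤ)) (2 ^ j)) with hbox
  have hcard : ∀ j, ((box j).card : ℝ≥0∞) ^ (1 / σ) ≤
      ENNReal.ofReal (3 ^ (d / σ) * (2 : ℝ) ^ (d / σ * j)) := by
    intro j
    have h1 : ((box j).card : ℝ) ≤ (3 * 2 ^ j) ^ d := by
      simp only [hbox, Fintype.card_piFinset, Int.card_Icc, Finset.prod_const, Finset.card_univ,
        Fintype.card_fin, Nat.cast_pow]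
      gcongr
      have h2 : (((2 ^ j + 1 - -2 ^ j : ℤ).toNat : ℤ) : ℝ) = 2 ^ j + 1 + 2 ^ j := by
        rw [Int.toNat_of_nonneg (by have : (0 : ℤ) ≤ 2 ^ j := by positivity
                                    linarith)]
        push_cast
        ring
      have h3 : (1 : ℝ) ≤ 2 ^ j := one_le_pow₀ (by norm_num)
      have h4 : (((2 ^ j + 1 - -2 ^ j : ℤ).toNat : ℕ) : ℝ) = 2 ^ j + 1 + 2 ^ j := by
        rw [← h2]; norm_cast
      rw [h4]
      linarith
    rw [← ENNReal.ofReal_natCast, ENNReal.ofReal_rpow_of_nonneg (by positivity) (by positivity)]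
    apply ENNReal.ofReal_le_ofReal
    calc ((box j).card : ℝ) ^ (1 / σ) ≤ ((3 * 2 ^ j) ^ d : ℝ) ^ (1 / σ) := by gcongr
      _ = _ := by
        rw [← Real.rpow_natCast _ d, ← Real.rpow_mul (by positivity), mul_one_div,
          Real.mul_rpow (by positivity) (by positivity), ← Real.rpow_natCast 2 j,
          ← Real.rpow_mul (by positivity), mul_comm (j : ℝ)]
  calc ∑' k, ENNReal.ofReal (bracketSq k ^ (-s)) * b k
      ≤ ∑' k, ∑' j : ℕ, ENNReal.ofReal (4 ^ s * (2 : ℝ) ^ (-(2 * s) * j)) *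
          (box j : Set (Fin d → ℤ)).indicator b k := by
        refine ENNReal.tsum_le_tsum fun k => ?_
        obtain ⟨j, hj, hle⟩ := exists_dyadic_box hs0 k
        refine le_trans ?_ (ENNReal.le_tsum j)
        rw [indicator_of_mem (by exact_mod_cast hj)]
        gcongr
    _ = ∑' j : ℕ, ENNReal.ofReal (4 ^ s * (2 : ℝ) ^ (-(2 * s) * j)) * ∑ k ∈ box j, b k := by
        rw [ENNReal.tsum_comm]
        refine tsum_congr fun j => ?_
        rw [ENNReal.tsum_mul_left, sum_eq_tsum_indicator]
    _ ≤ ∑' j : ℕ, ENNReal.ofReal (4 ^ s * 3 ^ (d / σ) * r ^ j) * B := by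
        refine ENNReal.tsum_le_tsum fun j => ?_
        have hne : (box j).Nonempty := ⟨0, by simp [hbox]⟩
        calc _ ≤ ENNReal.ofReal (4 ^ s * (2 : ℝ) ^ (-(2 * s) * j)) *
              (B * ENNReal.ofReal (3 ^ (d / σ) * (2 : ℝ) ^ (d / σ * j))) := by
              gcongr
              exact (hb _ hne).trans (by gcongr; exact hcard j)
          _ = _ := by
              rw [mul_left_comm, ← ENNReal.ofReal_mul (by positivity), mul_comm B]
              congr 2
              rw [hr, ← Real.rpow_natCast, ← Real.rpow_mul (by norm_num), sub_mul,
                sub_eq_add_neg, Real.rpow_add (by norm_num), neg_mul]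
              ring
    _ = _ := ENNReal.tsum_mul_right

/-- If `|g|² ≤ V Φ` with `V ∈ L^σ` and `Φ ∈ L¹`, then `g ∈ H^{-s}` for `2s > d/σ`. -/
theorem exists_sobolev_neg_le (d : ℕ) {σ s : ℝ} (hσ : 1 ≤ σ) (hs : d / σ < 2 * s) :
    ∃ K : ℝ≥0∞, K ≠ ⊤ ∧ ∀ (V Φ : Torus d → ℝ≥0∞) (g : Torus d → ℂ),
      AEMeasurable V → AEMeasurable Φ → AEStronglyMeasurable g →
      (∀ᵐ x, ‖g x‖ₑ ^ 2 ≤ V x * Φ x) → ∫⁻ x, V x ^ σ ≠ ⊤ → ∫⁻ x, Φ x ≠ ⊤ →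
      ∑' k, ENNReal.ofReal (bracketSq k ^ (-s)) * ‖mFourierCoeff g k‖ₑ ^ 2 ≤
        K * (1 + ∫⁻ x, V x ^ σ) * ∫⁻ x, Φ x := by
  obtain ⟨K, hK, h⟩ := exists_tsum_bracketSq_rpow_neg_mul_le d (σ := σ) (by linarith) hs
  refine ⟨K * 2, by finiteness, fun V Φ g hV hΦ hg hgV hVσ hΦi => ?_⟩
  refine (h _ (2 * (1 + ∫⁻ x, V x ^ σ) * ∫⁻ x, Φ x) fun S hS => ?_).trans_eq (by ring)
  exact (sum_enorm_sq_mFourierCoeff_le hσ hV hΦ hg hgV hVσ hΦi hS).trans_eq (by ring)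

/-! ### Duality: from `H^{-s}` bounds to form bounds -/

theorem ennreal_two_mul_mul_le {c l : ℝ≥0∞} (hc0 : c ≠ 0) (hc : c ≠ ⊤) (hl0 : l ≠ 0) (hl : l ≠ ⊤)
    (a b : ℝ≥0∞) : 2 * (a * b) ≤ c * (l * a ^ 2) + c⁻¹ * (l⁻¹ * b ^ 2) := by
  have hcl0 : c * l ≠ 0 := mul_ne_zero hc0 hl0
  have hcl : c * l ≠ ⊤ := ENNReal.mul_ne_top hc hl
  rw [← mul_assoc c, ← mul_assoc c⁻¹, ← ENNReal.mul_inv (.inl hc0) (.inl hc)]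
  generalize c * l = e at hcl0 hcl
  rcases eq_or_ne a ⊤ with rfl | ha
  · simp [ENNReal.mul_top hcl0]
  rcases eq_or_ne b ⊤ with rfl | hb
  · simp [ENNReal.mul_top (ENNReal.inv_ne_zero.2 hcl)]
  lift a to NNReal using ha
  lift b to NNReal using hb
  lift e to NNReal using hcl
  have he : e ≠ 0 := by simpa using hcl0
  rw [← ENNReal.coe_inv he]
  norm_cast
  rw [← NNReal.coe_le_coe]
  push_cast
  have he' : (0 : ℝ) < e := by positivity
  have : (e : ℝ) * a ^ 2 + (e : ℝ)⁻¹ * b ^ 2 - 2 * (a * b) = (e : ℝ)⁻¹ * (e * a - b) ^ 2 := by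
    field_simp
    ring
  nlinarith [mul_nonneg (inv_nonneg.2 he'.le) (sq_nonneg ((e : ℝ) * a - b))]

/-- With `φ = V w` and `Φ = V|w|²`, both cut off to `V ≤ M`, one has `∫Φ = ⟨w, φ⟩` and `|φ|² = VΦ`.
Pairing `H^s` with `H^{-s}` and using the hypothesis for `φ` bounds `∫Φ` by `‖w‖_{H^s} (K∫Φ)^{1/2}`,
and `∫Φ` is absorbed. The cutoff makes `∫Φ` finite, as the absorption requires; the bound does not
depend on `M`. -/
theorem lintegral_mul_enorm_sq_le_of_bounded {V : Torus d → ℝ≥0∞} (hV : Measurable V)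
    {w : Torus d → ℂ} (hw : MemLp w 2) {s : ℝ} {K : ℝ≥0∞} (hK0 : K ≠ 0) (hK : K ≠ ⊤)
    (h : ∀ (Φ : Torus d → ℝ≥0∞) (g : Torus d → ℂ), AEMeasurable Φ → AEStronglyMeasurable g →
      (∀ᵐ x, ‖g x‖ₑ ^ 2 ≤ V x * Φ x) → ∫⁻ x, Φ x ≠ ⊤ →
      ∑' k, ENNReal.ofReal (bracketSq k ^ (-s)) * ‖mFourierCoeff g k‖ₑ ^ 2 ≤ K * ∫⁻ x, Φ x)
    (M : ℕ) :
    ∫⁻ x in {x | V x ≤ M}, V x * ‖w x‖ₑ ^ 2 ≤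
      K * ∑' k, ENNReal.ofReal (bracketSq k ^ s) * ‖mFourierCoeff w k‖ₑ ^ 2 := by
  set A : Set (Torus d) := {x | V x ≤ M}
  have hA : MeasurableSet A := measurableSet_le hV measurable_const
  set Φ : Torus d → ℝ≥0∞ := A.indicator fun x => V x * ‖w x‖ₑ ^ 2 with hΦdef
  set φ : Torus d → ℂ := A.indicator fun x => ((V x).toReal : ℂ) * w x with hφdef
  have hΦ : AEMeasurable Φ :=
    (hV.aemeasurable.mul (hw.1.enorm.pow_const 2)).indicator hA
  have hφ : AEStronglyMeasurable φ :=
    ((Complex.measurable_ofReal.comp hV.ennreal_toReal).aestronglyMeasurable.mul hw.1).indicator hA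
  have hw2 : ∫⁻ x, ‖w x‖ₑ ^ 2 ≠ ⊤ := by
    have := (eLpNorm_lt_top_iff_lintegral_rpow_enorm_lt_top (by norm_num) (by norm_num)).1 hw.2
    simpa using this.ne
  have hΦi : ∫⁻ x, Φ x ≠ ⊤ := by
    refine ne_top_of_le_ne_top (b := M * ∫⁻ x, ‖w x‖ₑ ^ 2) (by finiteness) ?_
    rw [← lintegral_const_mul'' _ (hw.1.enorm.pow_const 2)]
    refine lintegral_mono fun x => ?_
    by_cases hx : x ∈ A
    · simp only [hΦdef, hx, indicator_of_mem]
      gcongr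
      exact hx
    · simp [hΦdef, hx]
  have hφΦ : ∀ x, ‖φ x‖ₑ ^ 2 = V x * Φ x := by
    intro x
    by_cases hx : x ∈ A
    · have hVt : V x ≠ ⊤ := ne_top_of_le_ne_top (by simp) hx
      have : ‖((V x).toReal : ℂ)‖ₑ = V x := by
        rw [← ofReal_norm, Complex.norm_real, Real.norm_of_nonneg ENNReal.toReal_nonneg,
          ENNReal.ofReal_toReal hVt]
      simp only [hφdef, hΦdef, hx, indicator_of_mem, enorm_mul, this]
      ring
    · simp [hφdef, hΦdef, hx]
  have hφ2 : MemLp φ 2 := by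
    refine memLp_two_of_lintegral_ne_top hφ (ne_top_of_le_ne_top (b := M * ∫⁻ x, Φ x)
      (by finiteness) ?_)
    rw [← lintegral_const_mul'' _ hΦ]
    refine lintegral_mono fun x => ?_
    rw [hφΦ]
    by_cases hx : x ∈ A
    · gcongr
      exact hx
    · simp [hΦdef, hx]
  have hinner : ∫⁻ x, Φ x ≤ ∑' k, ‖mFourierCoeff w k‖ₑ * ‖mFourierCoeff φ k‖ₑ := by
    have hs := hasSum_inner_mFourierCoeff hw hφ2
    have e1 : ∀ x, conj (w x) * φ x = (((Φ x).toReal : ℝ) : ℂ) := by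
      intro x
      by_cases hx : x ∈ A
      · simp only [hφdef, hΦdef, hx, indicator_of_mem, ENNReal.toReal_mul, ENNReal.toReal_pow,
          toReal_enorm]
        rw [mul_left_comm, Complex.conj_mul']
        push_cast
        ring
      · simp [hφdef, hΦdef, hx]
    simp_rw [e1] at hs
    rw [integral_complex_ofReal, integral_toReal hΦ (ae_lt_top' hΦ hΦi)] at hs
    have e2 : ∫⁻ x, Φ x = ‖(((∫⁻ x, Φ x).toReal : ℝ) : ℂ)‖ₑ := by
      rw [← ofReal_norm, Complex.norm_real, Real.norm_of_nonneg ENNReal.toReal_nonneg,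
        ENNReal.ofReal_toReal hΦi]
    rw [e2, ← hs.tsum_eq]
    refine enorm_tsum_le_tsum_enorm.trans_eq (tsum_congr fun k => ?_)
    rw [enorm_mul]
    congr 1
    rw [← ofReal_norm, ← ofReal_norm, RCLike.norm_conj]
  have hbr : ∀ k : Fin d → ℤ, 0 < bracketSq k := fun k => by linarith [one_le_bracketSq k]
  -- Young's inequality in each mode with weight `K⟨k⟩^{2s}`, so that the `φ` part returns exactly
  -- one copy of `∫Φ`.
  have hmain : 2 * ∫⁻ x, Φ x ≤
      K * (∑' k, ENNReal.ofReal (bracketSq k ^ s) * ‖mFourierCoeff w k‖ₑ ^ 2) + ∫⁻ x, Φ x := by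
    calc 2 * ∫⁻ x, Φ x ≤ ∑' k, 2 * (‖mFourierCoeff w k‖ₑ * ‖mFourierCoeff φ k‖ₑ) := by
          rw [ENNReal.tsum_mul_left]
          gcongr
      _ ≤ ∑' k, (K * (ENNReal.ofReal (bracketSq k ^ s) * ‖mFourierCoeff w k‖ₑ ^ 2) +
            K⁻¹ * (ENNReal.ofReal (bracketSq k ^ (-s)) * ‖mFourierCoeff φ k‖ₑ ^ 2)) := by
          refine ENNReal.tsum_le_tsum fun k => ?_
          rw [Real.rpow_neg (hbr k).le, ENNReal.ofReal_inv_of_pos (Real.rpow_pos_of_pos (hbr k) _)]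
          refine ennreal_two_mul_mul_le hK0 hK ?_ ENNReal.ofReal_ne_top _ _
          simpa using Real.rpow_pos_of_pos (hbr k) _
      _ ≤ K * (∑' k, ENNReal.ofReal (bracketSq k ^ s) * ‖mFourierCoeff w k‖ₑ ^ 2) +
            K⁻¹ * (K * ∫⁻ x, Φ x) := by
          rw [ENNReal.tsum_add, ENNReal.tsum_mul_left, ENNReal.tsum_mul_left]
          gcongr
          exact h Φ φ hΦ hφ (ae_of_all _ fun x => (hφΦ x).le) hΦi
      _ = _ := by rw [← mul_assoc, ENNReal.inv_mul_cancel hK0 hK, one_mul]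
  rw [two_mul] at hmain
  rw [← lintegral_indicator hA]
  exact (ENNReal.add_le_add_iff_right hΦi).1 hmain

/-- For `V ∈ L^σ` and `2s > d/σ` the form `∫ V |w|²` is bounded on `H^s`. -/
theorem exists_lintegral_mul_enorm_sq_le (d : ℕ) {σ s : ℝ} (hσ : 1 ≤ σ) (hs : d / σ < 2 * s) :
    ∃ K : ℝ≥0∞, K ≠ ⊤ ∧ ∀ (V : Torus d → ℝ≥0∞) (w : Torus d → ℂ),
      AEMeasurable V → MemLp w 2 → ∫⁻ x, V x ^ σ ≠ ⊤ →
      ∫⁻ x, V x * ‖w x‖ₑ ^ 2 ≤ K * (1 + ∫⁻ x, V x ^ σ) *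
        ∑' k, ENNReal.ofReal (bracketSq k ^ s) * ‖mFourierCoeff w k‖ₑ ^ 2 := by
  obtain ⟨K, hK, h⟩ := exists_sobolev_neg_le d hσ hs
  -- The `+ 1` makes the constant nonzero, since Young's inequality divides by it.
  refine ⟨K + 1, by finiteness, fun V w hV hw hVσ => ?_⟩
  have e : ∫⁻ x, V x ^ σ = ∫⁻ x, hV.mk V x ^ σ :=
    lintegral_congr_ae (hV.ae_eq_mk.mono fun x hx => by simp only [hx])
  have e' : ∫⁻ x, V x * ‖w x‖ₑ ^ 2 = ∫⁻ x, hV.mk V x * ‖w x‖ₑ ^ 2 :=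
    lintegral_congr_ae (hV.ae_eq_mk.mono fun x hx => by simp only [hx])
  rw [e] at hVσ ⊢
  rw [e']
  have hVm := hV.measurable_mk
  generalize hV.mk V = V' at hVσ hVm
  -- Remove the cutoff by monotone convergence: `V` is finite a.e. because `V^σ` is integrable.
  have hU : ∫⁻ x, V' x * ‖w x‖ₑ ^ 2 =
      ⨆ M : ℕ, ∫⁻ x in {x | V' x ≤ M}, V' x * ‖w x‖ₑ ^ 2 := by
    rw [← setLIntegral_iUnion_of_directed, ← setLIntegral_univ]
    · apply setLIntegral_congr
      have : ∀ᵐ x, V' x ^ σ < ⊤ := ae_lt_top (hVm.pow_const σ) hVσ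
      filter_upwards [this] with x hx
      have hx' : V' x ≠ ⊤ := by
        intro h0
        rw [h0, ENNReal.top_rpow_of_pos (by linarith)] at hx
        exact lt_irrefl _ hx
      obtain ⟨n, hn⟩ := ENNReal.exists_nat_gt hx'
      apply propext
      change True ↔ x ∈ ⋃ M : ℕ, {x | V' x ≤ M}
      simp only [mem_iUnion, true_iff]
      exact ⟨n, hn.le⟩
    · refine Monotone.directed_le fun m n hmn x (hx : V' x ≤ m) => ?_
      exact hx.trans (by exact_mod_cast hmn)
  rw [hU]
  refine iSup_le fun M => lintegral_mul_enorm_sq_le_of_bounded hVm hw (by simp) (by finiteness)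
    (fun Φ g hΦ hg hgV hΦi => ?_) M
  refine (h V' Φ g hVm.aemeasurable hΦ hg hgV hVσ hΦi).trans ?_
  gcongr
  exact le_self_add

/-! ### Interpolation between `L²` and `H¹` -/

theorem exists_rpow_le_mul_add {s ε : ℝ} (hs0 : 0 ≤ s) (hs : s < 1) (hε : 0 < ε) :
    ∃ C : ℝ, 0 ≤ C ∧ ∀ x : ℝ, 1 ≤ x → x ^ s ≤ ε * x + C := by
  have h := (tendsto_rpow_neg_atTop (show 0 < 1 - s by linarith)).eventually_le_const hε
  obtain ⟨R, hR⟩ := eventually_atTop.1 h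
  refine ⟨|R| ^ s, by positivity, fun x hx => ?_⟩
  rcases le_total R x with hRx | hRx
  · have h1 : x ^ s = x ^ (-(1 - s)) * x := by
      rw [← Real.rpow_add_one (by linarith)]
      ring_nf
    have h2 : 0 ≤ |R| ^ s := by positivity
    have h3 := mul_le_mul_of_nonneg_right (hR x hRx) (by linarith : 0 ≤ x)
    linarith
  · have : x ^ s ≤ |R| ^ s := Real.rpow_le_rpow (by linarith) (hRx.trans (le_abs_self R)) hs0
    nlinarith

theorem exists_tsum_bracketSq_rpow_le (d : ℕ) {s ε : ℝ} (hs0 : 0 ≤ s) (hs : s < 1) (hε : 0 < ε) :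
    ∃ C : ℝ≥0∞, C ≠ ⊤ ∧ ∀ b : (Fin d → ℤ) → ℝ≥0∞,
      ∑' k, ENNReal.ofReal (bracketSq k ^ s) * b k ≤
        ENNReal.ofReal ε * (∑' k, ENNReal.ofReal (bracketSq k) * b k) + C * ∑' k, b k := by
  obtain ⟨C, hC, h⟩ := exists_rpow_le_mul_add hs0 hs hε
  refine ⟨ENNReal.ofReal C, ENNReal.ofReal_ne_top, fun b => ?_⟩
  rw [← ENNReal.tsum_mul_left, ← ENNReal.tsum_mul_left, ← ENNReal.tsum_add]
  refine ENNReal.tsum_le_tsum fun k => ?_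
  have hb : 0 ≤ bracketSq k := by linarith [one_le_bracketSq k]
  rw [← mul_assoc, ← add_mul, ← ENNReal.ofReal_mul hε.le,
    ← ENNReal.ofReal_add (by positivity) hC]
  gcongr
  exact h _ (one_le_bracketSq k)

/-- A potential `V ∈ L^σ` with `σ > d/2` is form bounded with respect to `1 - Δ`, with arbitrarily
small bound. -/
theorem exists_lintegral_mul_enorm_sq_le_small (d : ℕ) {σ : ℝ} (hσ : 1 ≤ σ) (hd : d / σ < 2)
    {M : ℝ≥0∞} (hM : M ≠ ⊤) {ε : ℝ≥0∞} (hε : ε ≠ 0) :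
    ∃ C : ℝ≥0∞, C ≠ ⊤ ∧ ∀ (V : Torus d → ℝ≥0∞) (w : Torus d → ℂ),
      AEMeasurable V → MemLp w 2 → ∫⁻ x, V x ^ σ ≤ M →
      ∫⁻ x, V x * ‖w x‖ₑ ^ 2 ≤
        ε * (∑' k, ENNReal.ofReal (bracketSq k) * ‖mFourierCoeff w k‖ₑ ^ 2) +
          C * ∑' k, ‖mFourierCoeff w k‖ₑ ^ 2 := by
  -- The open condition `d/σ < 2` leaves room for an exponent `s < 1`; this gap is what produces the
  -- small constant.
  obtain ⟨s, hs1, hs2⟩ := exists_between (show d / σ / 2 < 1 by linarith)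
  have hs0 : 0 ≤ s := le_trans (by positivity) hs1.le
  obtain ⟨K, hK, h⟩ := exists_lintegral_mul_enorm_sq_le d (s := s) hσ (by linarith)
  have hKM : K * (1 + M) + 1 ≠ ⊤ := by finiteness
  obtain ⟨δ, hδ0, hδ⟩ : ∃ δ : ℝ, 0 < δ ∧ (K * (1 + M) + 1) * ENNReal.ofReal δ ≤ ε := by
    obtain ⟨δ, hδ1, hδ2⟩ := ENNReal.lt_iff_exists_nnreal_btwn.1
      (ENNReal.div_pos hε hKM)
    refine ⟨δ, by exact_mod_cast hδ1, ?_⟩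
    rw [ENNReal.ofReal_coe_nnreal, mul_comm]
    exact ENNReal.mul_le_of_le_div hδ2.le
  obtain ⟨C, hC, hint⟩ := exists_tsum_bracketSq_rpow_le d hs0 hs2 hδ0
  refine ⟨(K * (1 + M) + 1) * C, by finiteness, fun V w hV hw hVσ => ?_⟩
  calc _ ≤ K * (1 + M) *
        ∑' k, ENNReal.ofReal (bracketSq k ^ s) * ‖mFourierCoeff w k‖ₑ ^ 2 :=
        (h V w hV hw (ne_top_of_le_ne_top hM hVσ)).trans (by gcongr)
    _ ≤ (K * (1 + M) + 1) *
        (ENNReal.ofReal δ * (∑' k, ENNReal.ofReal (bracketSq k) * ‖mFourierCoeff w k‖ₑ ^ 2) +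
          C * ∑' k, ‖mFourierCoeff w k‖ₑ ^ 2) := by
        gcongr
        · exact le_self_add
        · exact hint _
    _ ≤ _ := by
        rw [mul_add, ← mul_assoc, ← mul_assoc]
        gcongr

/-! ### Energy identity for a single Fourier mode, and Grönwall's inequality -/

/-- A primitive of an `L¹` function is absolutely continuous, which suffices for the product rule;
no continuity of `p` is needed. -/
theorem sq_intervalIntegral_eq {p : ℝ → ℝ} {t : ℝ} (hp : IntervalIntegrable p volume 0 t) :
    (∫ r in (0 : ℝ)..t, p r) ^ 2 = ∫ s in (0 : ℝ)..t, 2 * ((∫ r in (0 : ℝ)..s, p r) * p s) := by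
  have hac := hp.absolutelyContinuousOnInterval_intervalIntegral (c := 0) (by simp)
  have h := hac.integral_deriv_mul_eq_sub hac
  simp only [intervalIntegral.integral_same, mul_zero, sub_zero] at h
  rw [sq, ← h]
  apply intervalIntegral.integral_congr_ae
  filter_upwards [hp.ae_hasDerivAt_integral] with s hs hst
  rw [(hs (uIoc_subset_uIcc hst) 0 (by simp)).deriv]
  ring

theorem norm_sq_intervalIntegral_eq {p : ℝ → ℂ} {t : ℝ} (hp : IntervalIntegrable p volume 0 t) :
    ‖∫ r in (0 : ℝ)..t, p r‖ ^ 2 =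
      ∫ s in (0 : ℝ)..t, 2 * (conj (∫ r in (0 : ℝ)..s, p r) * p s).re := by
  have hre : IntervalIntegrable (fun r => (p r).re) volume 0 t := ⟨hp.1.re, hp.2.re⟩
  have him : IntervalIntegrable (fun r => (p r).im) volume 0 t := ⟨hp.1.im, hp.2.im⟩
  have key : ∀ s ∈ uIcc 0 t, (∫ r in (0 : ℝ)..s, p r).re = (∫ r in (0 : ℝ)..s, (p r).re) ∧
      (∫ r in (0 : ℝ)..s, p r).im = (∫ r in (0 : ℝ)..s, (p r).im) := by
    intro s hs
    have hps : IntervalIntegrable p volume 0 s := hp.mono_set (uIcc_subset_uIcc_left hs)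
    exact ⟨(Complex.reCLM.intervalIntegral_comp_comm hps).symm,
      (Complex.imCLM.intervalIntegral_comp_comm hps).symm⟩
  have hac1 := hre.absolutelyContinuousOnInterval_intervalIntegral (c := 0) (by simp)
  have hac2 := him.absolutelyContinuousOnInterval_intervalIntegral (c := 0) (by simp)
  rw [← Complex.normSq_eq_norm_sq, Complex.normSq_apply, (key t (by simp)).1, (key t (by simp)).2,
    ← sq, ← sq, sq_intervalIntegral_eq hre, sq_intervalIntegral_eq him,
    ← intervalIntegral.integral_add]
  · apply intervalIntegral.integral_congr
    intro s hs
    simp only [Complex.mul_re, Complex.conj_re, Complex.conj_im, (key s hs).1, (key s hs).2]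
    ring
  · exact (hre.continuousOn_mul hac1.continuousOn).const_mul 2
  · exact (him.continuousOn_mul hac2.continuousOn).const_mul 2

theorem ofReal_integral_le_lintegral_ofReal {α : Type*} [MeasurableSpace α] {μ : Measure α}
    {f : α → ℝ} (hf : Integrable f μ) :
    ENNReal.ofReal (∫ x, f x ∂μ) ≤ ∫⁻ x, ENNReal.ofReal (f x) ∂μ := by
  rw [integral_eq_lintegral_pos_part_sub_lintegral_neg_part hf]
  refine (ENNReal.ofReal_le_ofReal (sub_le_self _ ENNReal.toReal_nonneg)).trans ?_
  exact ENNReal.ofReal_toReal_le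

/-- Weighted supremum argument: for `Y = sup E(t)e^{-lt}` with `l` large, the integral inequality
gives `Y ≤ Y/2`, while integrability of `E` makes `Y` finite. Neither continuity nor measurability
of `E` is involved. -/
theorem gronwall_lintegral {E : ℝ → ℝ≥0∞} {T : ℝ} {C : ℝ≥0∞} (hC : C ≠ ⊤)
    (hE : ∀ t ∈ Icc 0 T, E t ≤ C * ∫⁻ s in Ioo 0 t, E s) (hfin : ∫⁻ s in Ioo 0 T, E s ≠ ⊤) :
    ∀ t ∈ Icc 0 T, E t = 0 := by
  -- Chosen so that `C/l ≤ 1/2`; the `+ 1` keeps `l` positive when `C = 0`.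
  set l : ℝ := 2 * C.toReal + 1 with hl
  have hl0 : 0 < l := by positivity
  set e : ℝ → ℝ≥0∞ := fun t => ENNReal.ofReal (Real.exp (l * t)) with he
  have he0 : ∀ t, e t ≠ 0 := fun t => by simpa [he] using Real.exp_pos (l * t)
  have het : ∀ t, e t ≠ ⊤ := fun t => ENNReal.ofReal_ne_top
  set Y : ℝ≥0∞ := ⨆ t ∈ Icc 0 T, E t / e t with hY
  have hYtop : Y ≠ ⊤ := by
    refine ne_top_of_le_ne_top (b := C * ∫⁻ s in Ioo 0 T, E s) (by finiteness) ?_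
    refine iSup₂_le fun t ht => ?_
    have h1 : 1 ≤ e t := by
      rw [he, ENNReal.one_le_ofReal]
      exact Real.one_le_exp (mul_nonneg hl0.le ht.1)
    refine (ENNReal.div_le_of_le_mul ?_)
    calc E t ≤ C * ∫⁻ s in Ioo 0 t, E s := hE t ht
      _ ≤ (C * ∫⁻ s in Ioo 0 T, E s) * 1 := by
          rw [mul_one]
          gcongr
          exact ht.2
      _ ≤ _ := by gcongr
  have hEY : ∀ t ∈ Icc 0 T, E t ≤ Y * e t := fun t ht => by
    rw [← ENNReal.div_le_iff (he0 t) (het t)]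
    exact le_iSup₂ (f := fun t (_ : t ∈ Icc 0 T) => E t / e t) t ht
  have hint : ∀ t, 0 ≤ t → ∫⁻ s in Ioo 0 t, e s ≤ ENNReal.ofReal (l⁻¹) * e t := by
    intro t ht
    have hcont : Continuous fun s : ℝ => Real.exp (l * s) := by fun_prop
    rw [← ofReal_integral_eq_lintegral_ofReal
      ((hcont.integrableOn_Icc (a := 0) (b := t)).mono_set Ioo_subset_Icc_self)
      (ae_of_all _ fun s => (Real.exp_pos _).le), he, ← ENNReal.ofReal_mul (by positivity),
      ← integral_Ioc_eq_integral_Ioo, ← intervalIntegral.integral_of_le ht]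
    apply ENNReal.ofReal_le_ofReal
    have hd : ∀ x ∈ uIcc 0 t, HasDerivAt (fun s => l⁻¹ * Real.exp (l * s)) (Real.exp (l * x)) x := by
      intro x _
      have := (((hasDerivAt_id x).const_mul l).exp).const_mul l⁻¹
      simp only [id, mul_one] at this
      rwa [mul_comm (Real.exp _), inv_mul_cancel_left₀ hl0.ne'] at this
    rw [intervalIntegral.integral_eq_sub_of_hasDerivAt hd (hcont.intervalIntegrable _ _)]
    have : 0 ≤ l⁻¹ * Real.exp (l * 0) := by positivity
    linarith
  have hhalf : Y ≤ 2⁻¹ * Y := by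
    refine iSup₂_le fun t ht => ENNReal.div_le_of_le_mul ?_
    calc E t ≤ C * ∫⁻ s in Ioo 0 t, E s := hE t ht
      _ ≤ C * ∫⁻ s in Ioo 0 t, Y * e s := by
          refine mul_le_mul_right ?_ _
          exact setLIntegral_mono' measurableSet_Ioo fun s hs =>
            hEY s ⟨hs.1.le, hs.2.le.trans ht.2⟩
      _ ≤ C * (Y * (ENNReal.ofReal (l⁻¹) * e t)) := by
          rw [lintegral_const_mul' _ _ hYtop]
          gcongr
          exact hint t ht.1
      _ = C * ENNReal.ofReal (l⁻¹) * (Y * e t) := by ring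
      _ ≤ 2⁻¹ * (Y * e t) := by
          gcongr
          conv_lhs => rw [← ENNReal.ofReal_toReal hC]
          rw [← ENNReal.ofReal_mul ENNReal.toReal_nonneg, ← ENNReal.ofReal_ofNat 2,
            ← ENNReal.ofReal_inv_of_pos (by norm_num)]
          apply ENNReal.ofReal_le_ofReal
          rw [← div_eq_mul_inv, div_le_iff₀ hl0, hl]
          linarith [ENNReal.toReal_nonneg (a := C)]
      _ = _ := by ring
  have hY0 : Y = 0 := by
    by_contra h0
    have h1 := ENNReal.half_lt_self h0 hYtop
    rw [ENNReal.div_eq_inv_mul] at h1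
    exact absurd h1 (not_lt.2 hhalf)
  intro t ht
  have := hEY t ht
  rw [hY0, zero_mul] at this
  exact le_antisymm this zero_le

/-! ### Testing with trigonometric monomials -/

theorem mFourier_add_single (k : Fin d → ℤ) (j : Fin d) (x : Torus d) (s : ℝ) :
    mFourier k (x + Pi.single j (s : UnitAddCircle)) =
      mFourier k x * Complex.exp (2 * Real.pi * Complex.I * k j * s) := by
  have h1 : ∀ i, fourier (k i) ((x + Pi.single j (s : UnitAddCircle) : Torus d) i) =
      fourier (k i) (x i) * fourier (k i) ((Pi.single j (s : UnitAddCircle) : Torus d) i) := by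
    intro i
    simp [fourier_apply, smul_add, AddCircle.toCircle_add]
  simp only [mFourier, ContinuousMap.coe_mk]
  rw [Finset.prod_congr rfl fun i _ => h1 i, Finset.prod_mul_distrib]
  congr 1
  rw [Finset.prod_eq_single j (fun i _ hi => by simp [Pi.single_eq_of_ne hi]) (by simp),
    Pi.single_eq_same, fourier_coe_apply]
  simp

/-- The real trigonometric monomial `x ↦ Re (z e^{2πi k·x})`. -/
noncomputable def trigMonomial (z : ℂ) (k : Fin d → ℤ) (x : Torus d) : ℝ := (z * mFourier k x).re

theorem partialDeriv_trigMonomial (z : ℂ) (k : Fin d → ℤ) (j : Fin d) :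
    partialDeriv j (trigMonomial z k) = trigMonomial (2 * Real.pi * Complex.I * k j * z) k := by
  ext x
  have h : HasDerivAt (fun s : ℝ => z * (mFourier k x *
      Complex.exp (2 * Real.pi * Complex.I * k j * s)))
      (z * (mFourier k x * (2 * Real.pi * Complex.I * k j))) 0 := by
    have h1 : HasDerivAt (fun s : ℝ => 2 * Real.pi * Complex.I * k j * (s : ℂ))
        (2 * Real.pi * Complex.I * k j) 0 := by
      simpa using (Complex.ofRealCLM.hasDerivAt (x := 0)).const_mul (2 * Real.pi * Complex.I * k j)
    simpa using ((h1.cexp).const_mul (mFourier k x)).const_mul z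
  have h2 : HasDerivAt (fun s : ℝ => (z * (mFourier k x *
      Complex.exp (2 * Real.pi * Complex.I * k j * s))).re)
      (z * (mFourier k x * (2 * Real.pi * Complex.I * k j))).re 0 :=
    Complex.reCLM.hasFDerivAt.comp_hasDerivAt 0 h
  simp only [partialDeriv, trigMonomial, mFourier_add_single]
  rw [h2.deriv]
  congr 1
  ring

theorem laplacian_trigMonomial (z : ℂ) (k : Fin d → ℤ) (x : Torus d) :
    laplacian (trigMonomial z k) x =
      -(4 * Real.pi ^ 2 * ∑ j, (k j : ℝ) ^ 2) * trigMonomial z k x := by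
  simp only [laplacian, partialDeriv_trigMonomial]
  rw [Finset.mul_sum, ← Finset.sum_neg_distrib, Finset.sum_mul]
  refine Finset.sum_congr rfl fun j _ => ?_
  have : 2 * Real.pi * Complex.I * k j * (2 * Real.pi * Complex.I * k j * z) * mFourier k x =
      ((-(4 * Real.pi ^ 2 * (k j : ℝ) ^ 2) : ℝ) : ℂ) * (z * mFourier k x) := by
    push_cast
    linear_combination 4 * Real.pi ^ 2 * (k j : ℂ) ^ 2 * z * mFourier k x * Complex.I_sq
  rw [trigMonomial, this, Complex.re_ofReal_mul, trigMonomial]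

/-- The vector-valued test function with `i`-th component `Re (z e^{2πi k·x})`. -/
noncomputable def trigTest {ℓ : ℕ} (i : Fin ℓ) (z : ℂ) (k : Fin d → ℤ) (x : Torus d) : Vec ℓ :=
  EuclideanSpace.single i (trigMonomial z k x)

theorem trigTest_apply_self {ℓ : ℕ} (i : Fin ℓ) (z : ℂ) (k : Fin d → ℤ) :
    (fun x : Torus d => trigTest i z k x i) = trigMonomial z k := by
  ext x
  simp [trigTest]

theorem trigTest_apply_of_ne {ℓ : ℕ} {i i' : Fin ℓ} (h : i' ≠ i) (z : ℂ) (k : Fin d → ℤ) :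
    (fun x : Torus d => trigTest i z k x i') = fun _ => 0 := by
  ext x
  simp [trigTest, h]

theorem smooth_trigTest {ℓ : ℕ} (i : Fin ℓ) (z : ℂ) (k : Fin d → ℤ) :
    Smooth (trigTest (d := d) i z k) := by
  rw [Smooth, contDiff_euclidean]
  intro i'
  by_cases h : i' = i
  · subst h
    have : (fun y : Fin d → ℝ => trigTest i' z k (fun j => (y j : UnitAddCircle)) i') =
        fun y => Complex.reCLM
          (z * ∏ j, Complex.exp (2 * Real.pi * Complex.I * k j * Complex.ofRealCLM (y j))) := by
      ext y
      rw [congr_fun (trigTest_apply_self i' z k)]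
      simp [trigMonomial, mFourier]
    rw [this]
    refine Complex.reCLM.contDiff.comp (contDiff_const.mul (contDiff_prod fun j _ => ?_))
    exact (contDiff_const.mul (Complex.ofRealCLM.contDiff.comp (contDiff_apply ℝ ℝ j))).cexp
  · have : (fun y : Fin d → ℝ => trigTest i z k (fun j => (y j : UnitAddCircle)) i') =
        fun _ => 0 := by
      ext y
      exact congr_fun (trigTest_apply_of_ne h z k) _
    rw [this]
    exact contDiff_const

theorem integral_mFourier (k : Fin d → ℤ) :
    ∫ x : Torus d, mFourier k x = if k = 0 then 1 else 0 := by
  have h := orthonormal_iff_ite.mp (UnitAddTorus.orthonormal_mFourier (d := Fin d)) 0 k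
  rw [ContinuousMap.inner_toLp] at h
  simp only [UnitAddTorus.mFourier_zero, ContinuousMap.one_apply, map_one, mul_one] at h
  rw [volume_torus]
  refine Eq.trans h ?_
  simp [eq_comm]

theorem mFourierCoeff_trigMonomial (z : ℂ) (k k' : Fin d → ℤ) :
    mFourierCoeff (fun x => ((trigMonomial z k x : ℝ) : ℂ)) k' =
      (if k' = k then z / 2 else 0) + (if k' = -k then conj z / 2 else 0) := by
  rw [mFourierCoeff_eq_integral_mul]
  have h : ∀ x : Torus d, mFourier (-k') x * ((trigMonomial z k x : ℝ) : ℂ) =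
      z / 2 * mFourier (-k' + k) x + conj z / 2 * mFourier (-k' + -k) x := by
    intro x
    rw [trigMonomial, Complex.re_eq_add_conj, UnitAddTorus.mFourier_add, UnitAddTorus.mFourier_add,
      map_mul, ← UnitAddTorus.mFourier_neg]
    ring
  have hi : ∀ m : Fin d → ℤ, Integrable fun x : Torus d => mFourier m x := fun m => by
    simpa using integrable_mFourier_mul (integrable_const (1 : ℂ)) m
  simp_rw [h]
  rw [integral_add ((hi _).const_mul _) ((hi _).const_mul _), integral_const_mul,
    integral_const_mul, integral_mFourier, integral_mFourier]
  have e1 : -k' + k = 0 ↔ k' = k := by rw [neg_add_eq_zero]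
  have e2 : -k' + -k = 0 ↔ k' = -k := by rw [neg_add_eq_zero]
  simp [e1, e2]

/-- A real monomial has only the frequencies `k` and `-k`, each with half the mass; the reality
condition on `c` makes the two contributions equal. For `k = 0` the two terms fall on the same
frequency and still add up correctly. -/
theorem pairing_trigTest {ℓ : ℕ} {c : FourierFamily d ℓ} (i : Fin ℓ) (z : ℂ) (k : Fin d → ℤ)
    (hc : c i (-k) = star (c i k)) : pairing c (trigTest i z k) = (conj z * c i k).re := by
  have h : ∀ k', ∑ i', (c i' k' * star (fourierFamily (trigTest i z k) i' k')).re =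
      (if k' = k then (conj z * c i k).re / 2 else 0) +
        (if k' = -k then (conj z * c i k).re / 2 else 0) := by
    intro k'
    rw [Finset.sum_eq_single i]
    · have : fourierFamily (trigTest i z k) i k' =
          mFourierCoeff (fun x => ((trigMonomial z k x : ℝ) : ℂ)) k' := by
        simp only [fourierFamily, congr_fun (trigTest_apply_self i z k)]
      rw [this, mFourierCoeff_trigMonomial]
      have e1 : ∀ w : ℂ, (w * star (z / 2)).re = (conj z * w).re / 2 := by
        intro w
        simp [Complex.mul_re]
        ring
      have e2 : ∀ w : ℂ, (star w * star (conj z / 2)).re = (conj z * w).re / 2 := by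
        intro w
        simp [Complex.mul_re]
        ring
      rw [star_add, mul_add, Complex.add_re]
      congr 1
      · split_ifs with hk
        · rw [hk, e1]
        · simp
      · split_ifs with hk
        · rw [hk, hc, e2]
        · simp
    · intro i' _ hi'
      have : fourierFamily (trigTest i z k) i' k' = 0 := by
        simp only [fourierFamily, congr_fun (trigTest_apply_of_ne hi' z k)]
        simp [mFourierCoeff_eq_integral_mul]
      simp [this]
    · simp
  simp_rw [pairing, h]
  rw [((hasSum_ite_eq k _).add (hasSum_ite_eq (-k) _)).tsum_eq]
  ring

/-- The `k`-th Fourier coefficient of `μ Δv + f + div F`. -/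
noncomputable def evolutionCoeff (μ : ℝ) (v f : Torus d → ℝ) (F : Torus d → Vec d)
    (k : Fin d → ℤ) : ℂ :=
  -(4 * Real.pi ^ 2 * (∑ j, (k j : ℝ) ^ 2) * μ : ℝ) * mFourierCoeff (fun x => (v x : ℂ)) k +
    mFourierCoeff (fun x => (f x : ℂ)) k +
    2 * Real.pi * Complex.I * ∑ j, k j * mFourierCoeff (fun x => (F x j : ℂ)) k

theorem integrable_apply {α : Type*} [MeasurableSpace α] {ν : Measure α} {n : ℕ} {F : α → Vec n}
    (hF : Integrable F ν) (j : Fin n) : Integrable (fun x => F x j) ν :=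
  (EuclideanSpace.proj (𝕜 := ℝ) j).integrable_comp hF

/-- All derivatives already fall on the monomial, where they are explicit multipliers. The identity
is therefore pointwise algebra under the integral, without integration by parts. -/
theorem integral_trigMonomial {μ : ℝ} {v f : Torus d → ℝ} {F : Torus d → Vec d}
    (hv : Integrable v) (hf : Integrable f) (hF : Integrable F) (z : ℂ) (k : Fin d → ℤ) :
    ∫ x, (μ * v x * laplacian (trigMonomial z k) x + f x * trigMonomial z k x -
      inner ℝ (F x) (gradient (trigMonomial z k) x)) =
      (conj z * evolutionCoeff μ v f F k).re := by
  set N : ℝ := 4 * Real.pi ^ 2 * (∑ j, (k j : ℝ) ^ 2) * μ with hN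
  have iv : Integrable fun x => mFourier (-k) x * (v x : ℂ) :=
    integrable_mFourier_mul (hv.ofReal (𝕜 := ℂ)) (-k)
  have jf : Integrable fun x => mFourier (-k) x * (f x : ℂ) :=
    integrable_mFourier_mul (hf.ofReal (𝕜 := ℂ)) (-k)
  have iF : ∀ j, Integrable fun x => mFourier (-k) x * (F x j : ℂ) := fun j =>
    integrable_mFourier_mul ((integrable_apply hF j).ofReal (𝕜 := ℂ)) (-k)
  have hpt : ∀ x, μ * v x * laplacian (trigMonomial z k) x + f x * trigMonomial z k x -
      inner ℝ (F x) (gradient (trigMonomial z k) x) =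
      (conj z * (-(N : ℂ) * (mFourier (-k) x * v x) + mFourier (-k) x * f x +
        2 * Real.pi * Complex.I * ∑ j, k j * (mFourier (-k) x * F x j))).re := by
    intro x
    have hin : inner ℝ (F x) (gradient (trigMonomial z k) x) =
        ∑ j, trigMonomial (2 * Real.pi * Complex.I * k j * z) k x * F x j := by
      simp [PiLp.inner_apply, gradient, partialDeriv_trigMonomial]
    rw [laplacian_trigMonomial, hin]
    have e1 : ∀ j, trigMonomial (2 * Real.pi * Complex.I * k j * z) k x * F x j =
        -(2 * Real.pi * (z * mFourier k x).im) * (k j * F x j) := by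
      intro j
      have : 2 * Real.pi * Complex.I * k j * z * mFourier k x =
          ((2 * Real.pi * k j : ℝ) : ℂ) * (Complex.I * (z * mFourier k x)) := by
        push_cast; ring
      rw [trigMonomial, this, Complex.re_ofReal_mul, Complex.I_mul_re]
      ring
    simp_rw [e1]
    rw [← Finset.mul_sum]
    have e2 : conj z * (-(N : ℂ) * (mFourier (-k) x * v x) + mFourier (-k) x * f x +
        2 * Real.pi * Complex.I * ∑ j, k j * (mFourier (-k) x * F x j)) =
        conj (z * mFourier k x) * ((-N * v x + f x : ℝ) +
          (2 * Real.pi * (∑ j, (k j : ℝ) * F x j) : ℝ) * Complex.I) := by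
      rw [map_mul, ← UnitAddTorus.mFourier_neg]
      push_cast
      simp_rw [mul_left_comm (_ : ℂ) (mFourier (-k) x) _, ← Finset.mul_sum]
      ring
    rw [e2, trigMonomial]
    simp only [Complex.mul_re, Complex.conj_re, Complex.conj_im, Complex.add_re, Complex.add_im,
      Complex.ofReal_re, Complex.ofReal_im, Complex.mul_im, Complex.I_re, Complex.I_im]
    rw [hN]
    ring
  simp_rw [hpt]
  have i1 : Integrable fun x => -(N : ℂ) * (mFourier (-k) x * v x) + mFourier (-k) x * f x :=
    (iv.const_mul _).add jf
  have i2 : Integrable fun x => 2 * Real.pi * Complex.I *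
      ∑ j, k j * (mFourier (-k) x * F x j) :=
    (integrable_finsetSum _ fun j _ => (iF j).const_mul _).const_mul _
  refine (Complex.reCLM.integral_comp_comm ((i1.add i2).const_mul (conj z))).trans ?_
  rw [Complex.reCLM_apply, integral_const_mul]
  congr 2
  simp only [Pi.add_apply]
  rw [integral_add i1 i2,
    integral_add (iv.const_mul _) jf, integral_const_mul, integral_const_mul,
    integral_finsetSum _ fun j _ => (iF j).const_mul _]
  simp_rw [integral_const_mul]
  simp only [evolutionCoeff, mFourierCoeff_eq_integral_mul]
  rfl

theorem integral_trigTest {ℓ : ℕ} {μ : ℝ} {v : Torus d → Vec ℓ} {f : Torus d → ℝ}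
    {F : Torus d → Vec d} (hv : Integrable v) (hf : Integrable f) (hF : Integrable F)
    (i i' : Fin ℓ) (z : ℂ) (k : Fin d → ℤ) :
    ∫ x, (μ * v x i' * laplacian (fun y => trigTest i z k y i') x + f x * trigTest i z k x i' -
      inner ℝ (F x) (gradient (fun y => trigTest i z k y i') x)) =
      if i' = i then (conj z * evolutionCoeff μ (fun x => v x i') f F k).re else 0 := by
  split_ifs with h
  · subst h
    rw [trigTest_apply_self]
    simp_rw [congr_fun (trigTest_apply_self i' z k)]
    exact integral_trigMonomial (integrable_apply hv i') hf hF z k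
  · have h0 : ∀ j : Fin d, partialDeriv j (fun _ => (0 : ℝ)) = fun _ => 0 := by
      intro j
      ext x
      simp [partialDeriv]
    have h1 : ∀ x : Torus d, gradient (fun _ => (0 : ℝ)) x = 0 := by
      intro x
      ext j
      simp [gradient, h0]
    rw [trigTest_apply_of_ne h]
    simp_rw [congr_fun (trigTest_apply_of_ne h z k), h1]
    simp [laplacian, h0]

/-! ### The energy estimate -/

/-- Budget for `N = |k|²`: the Laplacian supplies at least `8π²mN|a|²`. Half pays for the flux term
by Young's inequality. The other half, at least `2mN|a|²` as `2 ≤ 4π²`, pays for the kept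
dissipation `m(1+N)|a|²` and for the same amount spent on the reaction term, up to the zero-order
rest `2m|a|²`. -/
theorem mode_dissipation_le {m μ : ℝ} (hm : 0 < m) (hμ : m ≤ μ) (k : Fin d → ℤ) (a g : ℂ)
    (G : Fin d → ℂ) :
    2 * (conj a * (-(4 * Real.pi ^ 2 * (∑ j, (k j : ℝ) ^ 2) * μ : ℝ) * a + g +
      2 * Real.pi * Complex.I * ∑ j, k j * G j)).re + m * bracketSq k * ‖a‖ ^ 2 ≤
      2 * m * ‖a‖ ^ 2 + m⁻¹ * (∑ j, ‖G j‖ ^ 2 + (bracketSq k)⁻¹ * ‖g‖ ^ 2) := by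
  set N : ℝ := ∑ j, (k j : ℝ) ^ 2 with hN
  have hN0 : 0 ≤ N := Finset.sum_nonneg fun _ _ => sq_nonneg _
  set X : ℂ := ∑ j, k j * G j with hX
  set B : ℝ := ∑ j, ‖G j‖ ^ 2
  have hb : 0 < bracketSq k := by linarith [one_le_bracketSq k]
  have hbN : bracketSq k = 1 + N := rfl
  have hXle : ‖X‖ ^ 2 ≤ N * B := by
    have h1 : ‖X‖ ≤ ∑ j, |(k j : ℝ)| * ‖G j‖ := by
      refine (norm_sum_le _ _).trans_eq (Finset.sum_congr rfl fun j _ => ?_)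
      rw [norm_mul, Complex.norm_intCast]
    have h2 := Finset.sum_mul_sq_le_sq_mul_sq Finset.univ (fun j => |(k j : ℝ)|) fun j => ‖G j‖
    simp only [sq_abs] at h2
    exact (pow_le_pow_left₀ (norm_nonneg _) h1 2).trans h2
  have e1 : (conj a * (-(4 * Real.pi ^ 2 * N * μ : ℝ) * a + g +
      2 * Real.pi * Complex.I * X)).re = -(4 * Real.pi ^ 2 * N * μ) * ‖a‖ ^ 2 +
      (conj a * g).re + (conj a * (2 * Real.pi * Complex.I * X)).re := by
    rw [mul_add, mul_add, Complex.add_re, Complex.add_re, mul_left_comm, Complex.conj_mul']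
    congr 2
    rw [← Complex.ofReal_neg, ← Complex.ofReal_pow, ← Complex.ofReal_mul, Complex.ofReal_re]
  have h1 : (conj a * g).re ≤ ‖a‖ * ‖g‖ := by
    refine (Complex.re_le_norm _).trans_eq ?_
    rw [norm_mul, RCLike.norm_conj]
  have h2 : (conj a * (2 * Real.pi * Complex.I * X)).re ≤ 2 * Real.pi * ‖a‖ * ‖X‖ := by
    refine (Complex.re_le_norm _).trans_eq ?_
    simp only [norm_mul, RCLike.norm_conj, Complex.norm_I, Complex.norm_real, Complex.norm_ofNat,
      Real.norm_of_nonneg Real.pi_pos.le]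
    ring
  have h3 : 2 * (‖a‖ * ‖g‖) ≤ m * bracketSq k * ‖a‖ ^ 2 +
      m⁻¹ * ((bracketSq k)⁻¹ * ‖g‖ ^ 2) := by
    have : m * bracketSq k * ‖a‖ ^ 2 + m⁻¹ * ((bracketSq k)⁻¹ * ‖g‖ ^ 2) - 2 * (‖a‖ * ‖g‖) =
        (m * bracketSq k)⁻¹ * (m * bracketSq k * ‖a‖ - ‖g‖) ^ 2 := by
      field_simp
      ring
    nlinarith [mul_nonneg (inv_nonneg.2 (mul_pos hm hb).le)
      (sq_nonneg (m * bracketSq k * ‖a‖ - ‖g‖))]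
  have h4 : 2 * (2 * Real.pi * ‖a‖ * ‖X‖) ≤ 4 * Real.pi ^ 2 * m * N * ‖a‖ ^ 2 + m⁻¹ * B := by
    have hY : ‖X‖ ≤ √N * √B := by
      rw [← Real.sqrt_mul hN0]
      exact Real.le_sqrt_of_sq_le hXle
    have hB0 : 0 ≤ B := Finset.sum_nonneg fun _ _ => sq_nonneg _
    have h5 : 2 * (2 * Real.pi * ‖a‖ * ‖X‖) ≤ 2 * (2 * Real.pi * ‖a‖ * (√N * √B)) := by
      gcongr
    have h6 : 4 * Real.pi ^ 2 * m * √N ^ 2 * ‖a‖ ^ 2 + m⁻¹ * √B ^ 2 -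
        2 * (2 * Real.pi * ‖a‖ * (√N * √B)) = m⁻¹ * (2 * Real.pi * m * ‖a‖ * √N - √B) ^ 2 := by
      field_simp
      ring
    have h7 := mul_nonneg (inv_nonneg.2 hm.le)
      (sq_nonneg (2 * Real.pi * m * ‖a‖ * √N - √B))
    rw [Real.sq_sqrt hN0, Real.sq_sqrt hB0] at h6
    linarith
  have h8 : 4 * Real.pi ^ 2 * N * m * ‖a‖ ^ 2 ≤ 4 * Real.pi ^ 2 * N * μ * ‖a‖ ^ 2 := by gcongr
  have h9 : 2 * (m * N * ‖a‖ ^ 2) ≤ 4 * Real.pi ^ 2 * N * m * ‖a‖ ^ 2 := by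
    have hpi : 2 ≤ 4 * Real.pi ^ 2 := by nlinarith [Real.pi_gt_three]
    have := mul_le_mul_of_nonneg_right hpi (show 0 ≤ m * N * ‖a‖ ^ 2 by positivity)
    linarith
  rw [e1, mul_add m⁻¹, hbN] at *
  linarith

/-- Integrated form of `d/dt |a|² = 2 Re(ā φ)`, with the dissipation `c|a|²` added to both sides.
The pointwise bound `B` takes values in `ℝ≥0∞`, so that the inequalities can be summed over all
frequencies before anything is known to converge. -/
theorem mode_energy {T : ℝ} {a φ : ℝ → ℂ} (hφ : IntegrableOn φ (Ioo 0 T))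
    (ha : ∀ t ∈ Icc 0 T, a t = ∫ s in (0 : ℝ)..t, φ s) {c : ℝ} (hc : 0 ≤ c) {B : ℝ → ℝ≥0∞}
    (hB : ∀ᵐ s ∂volume.restrict (Ioo 0 T),
      ENNReal.ofReal (2 * (conj (a s) * φ s).re + c * ‖a s‖ ^ 2) ≤ B s)
    {t : ℝ} (ht : t ∈ Icc 0 T) :
    ‖a t‖ₑ ^ 2 + ENNReal.ofReal c * ∫⁻ s in Ioo 0 t, ‖a s‖ₑ ^ 2 ≤ ∫⁻ s in Ioo 0 t, B s := by
  have hsub : Ioo 0 t ⊆ Ioo 0 T := Ioo_subset_Ioo_right ht.2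
  have hφt : IntegrableOn φ (Ioo 0 t) := hφ.mono_set hsub
  have hφi : IntervalIntegrable φ volume 0 t := by
    rw [intervalIntegrable_iff_integrableOn_Ioo_of_le ht.1]
    exact hφt
  have hφc : IntegrableOn φ (Icc 0 t) := by rwa [integrableOn_Icc_iff_integrableOn_Ioo]
  have hcont : ContinuousOn (fun s => ∫ r in (0 : ℝ)..s, φ r) (Icc 0 t) := by
    rw [← uIcc_of_le ht.1]
    apply intervalIntegral.continuousOn_primitive_interval
    rwa [uIcc_of_le ht.1]
  have hae : ∀ s ∈ Ioo 0 t, a s = ∫ r in (0 : ℝ)..s, φ r := fun s hs =>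
    ha s ⟨hs.1.le, hs.2.le.trans ht.2⟩
  have i1 : IntegrableOn (fun s => 2 * (conj (∫ r in (0 : ℝ)..s, φ r) * φ s).re) (Icc 0 t) := by
    have h1 : IntegrableOn (fun s => conj (∫ r in (0 : ℝ)..s, φ r) * φ s) (Icc 0 t) :=
      IntegrableOn.continuousOn_mul (Complex.continuous_conj.comp_continuousOn hcont)
        hφc isCompact_Icc
    exact h1.re.const_mul 2
  have i2 : IntegrableOn (fun s => ‖∫ r in (0 : ℝ)..s, φ r‖ ^ 2) (Icc 0 t) :=
    (hcont.norm.pow 2).integrableOn_Icc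
  have e1 : ‖a t‖ ^ 2 + c * ∫ s in Ioo 0 t, ‖a s‖ ^ 2 =
      ∫ s in Ioo 0 t, (2 * (conj (a s) * φ s).re + c * ‖a s‖ ^ 2) := by
    have e2 : ∫ s in Ioo 0 t, ‖a s‖ ^ 2 = ∫ s in Ioo 0 t, ‖∫ r in (0 : ℝ)..s, φ r‖ ^ 2 :=
      setIntegral_congr_fun measurableSet_Ioo fun s hs => by simp only [hae s hs]
    have e3 : ∫ s in Ioo 0 t, (2 * (conj (a s) * φ s).re + c * ‖a s‖ ^ 2) =
        ∫ s in Ioo 0 t, (2 * (conj (∫ r in (0 : ℝ)..s, φ r) * φ s).re +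
          c * ‖∫ r in (0 : ℝ)..s, φ r‖ ^ 2) :=
      setIntegral_congr_fun measurableSet_Ioo fun s hs => by simp only [hae s hs]
    rw [e2, e3, ha t ht, norm_sq_intervalIntegral_eq hφi, integral_add
      (i1.mono_set Ioo_subset_Icc_self) ((i2.mono_set Ioo_subset_Icc_self).const_mul c),
      integral_const_mul c, intervalIntegral.integral_of_le ht.1, integral_Ioc_eq_integral_Ioo]
  have i2' : IntegrableOn (fun s => ‖a s‖ ^ 2) (Ioo 0 t) :=
    (i2.mono_set Ioo_subset_Icc_self).congr_fun (fun s hs => by simp only [hae s hs])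
      measurableSet_Ioo
  have i3 : IntegrableOn (fun s => 2 * (conj (a s) * φ s).re + c * ‖a s‖ ^ 2) (Ioo 0 t) :=
    ((i1.mono_set Ioo_subset_Icc_self).congr_fun (fun s hs => by simp only [hae s hs])
      measurableSet_Ioo).add (i2'.const_mul c)
  have e4 : ∫⁻ s in Ioo 0 t, ‖a s‖ₑ ^ 2 = ENNReal.ofReal (∫ s in Ioo 0 t, ‖a s‖ ^ 2) := by
    rw [ofReal_integral_eq_lintegral_ofReal i2' (ae_of_all _ fun s => by positivity)]
    exact lintegral_congr fun s => enorm_sq_eq_ofReal _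
  rw [e4, enorm_sq_eq_ofReal, ← ENNReal.ofReal_mul hc,
    ← ENNReal.ofReal_add (by positivity) (mul_nonneg hc (integral_nonneg fun s => by positivity)),
    e1]
  exact (ofReal_integral_le_lintegral_ofReal i3).trans
    (lintegral_mono_ae (ae_restrict_of_ae_restrict_of_subset hsub hB))

/-! ### Vector-valued forms of the Fourier estimates -/

theorem enorm_sq_eq_sum {n : ℕ} (w : Vec n) : ‖w‖ₑ ^ 2 = ∑ i, ‖w i‖ₑ ^ 2 := by
  simp_rw [enorm_sq_eq_ofReal]
  rw [EuclideanSpace.norm_sq_eq, ENNReal.ofReal_sum_of_nonneg fun i _ => by positivity]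

theorem enorm_apply_sq_le {n : ℕ} (w : Vec n) (i : Fin n) : ‖w i‖ₑ ^ 2 ≤ ‖w‖ₑ ^ 2 := by
  rw [enorm_sq_eq_sum]
  exact Finset.single_le_sum (f := fun i => ‖w i‖ₑ ^ 2) (fun _ _ => bot_le) (Finset.mem_univ i)

theorem enorm_complex_ofReal (x : ℝ) : ‖(x : ℂ)‖ₑ = ‖x‖ₑ := by
  rw [← ofReal_norm, ← ofReal_norm, Complex.norm_real]

theorem aestronglyMeasurable_apply {α : Type*} [MeasurableSpace α] {ν : Measure α} {n : ℕ}
    {w : α → Vec n} (hw : AEStronglyMeasurable w ν) (i : Fin n) :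
    AEStronglyMeasurable (fun x => (w x i : ℂ)) ν :=
  (Complex.continuous_ofReal.comp
    (EuclideanSpace.proj (𝕜 := ℝ) i).continuous).comp_aestronglyMeasurable hw

theorem memLp_two_apply {n : ℕ} {w : Torus d → Vec n} (hw : AEStronglyMeasurable w)
    (h : ∫⁻ x, ‖w x‖ₑ ^ 2 ≠ ⊤) (i : Fin n) : MemLp (fun x => (w x i : ℂ)) 2 := by
  refine memLp_two_of_lintegral_ne_top (aestronglyMeasurable_apply hw i)
    (ne_top_of_le_ne_top h (lintegral_mono fun x => ?_))
  rw [enorm_complex_ofReal]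
  exact enorm_apply_sq_le _ _

/-- Parseval's identity for vector-valued functions. -/
theorem tsum_enorm_sq_apply {n : ℕ} {w : Torus d → Vec n} (hw : AEStronglyMeasurable w)
    (h : ∫⁻ x, ‖w x‖ₑ ^ 2 ≠ ⊤) :
    ∑ i, ∑' k, ‖mFourierCoeff (fun x => (w x i : ℂ)) k‖ₑ ^ 2 = ∫⁻ x, ‖w x‖ₑ ^ 2 := by
  have hm : ∀ i ∈ Finset.univ, AEMeasurable (fun x => ‖w x i‖ₑ ^ 2) := fun i _ =>
    ((EuclideanSpace.proj (𝕜 := ℝ) i).continuous.comp_aestronglyMeasurable hw).enorm.pow_const 2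
  simp_rw [enorm_sq_eq_sum]
  rw [lintegral_finsetSum' _ hm]
  refine Finset.sum_congr rfl fun i _ => ?_
  rw [tsum_enorm_sq_mFourierCoeff (memLp_two_apply hw h i)]
  exact lintegral_congr fun x => by rw [enorm_complex_ofReal]

/-- The flux is estimated in `L²` by Parseval. The reaction satisfies `|g|² ≤ V·(cVW)`, so the
negative Sobolev estimate with `s = 1` applies, and its condition `2s > d/σ` is `d/σ < 2`. -/
theorem exists_tsum_nonlinearity_le (d : ℕ) {σ : ℝ} (hσ : 1 ≤ σ) (hd : d / σ < 2)
    {M c : ℝ≥0∞} (hM : M ≠ ⊤) (hc : c ≠ ⊤) :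
    ∃ K : ℝ≥0∞, K ≠ ⊤ ∧ ∀ (V W : Torus d → ℝ≥0∞) (g : Torus d → ℝ) (G : Torus d → Vec d),
      AEMeasurable V → AEMeasurable W → AEStronglyMeasurable g → AEStronglyMeasurable G →
      (∀ᵐ x, ‖g x‖ₑ ^ 2 ≤ c * (V x * (V x * W x))) → (∀ᵐ x, ‖G x‖ₑ ^ 2 ≤ c * (V x * W x)) →
      ∫⁻ x, V x ^ σ ≤ M → ∫⁻ x, V x * W x ≠ ⊤ →
      ∑' k, (∑ j, ‖mFourierCoeff (fun x => (G x j : ℂ)) k‖ₑ ^ 2 +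
        ENNReal.ofReal (bracketSq k)⁻¹ * ‖mFourierCoeff (fun x => (g x : ℂ)) k‖ₑ ^ 2) ≤
        K * ∫⁻ x, V x * W x := by
  obtain ⟨K, hK, h⟩ := exists_sobolev_neg_le d (s := 1) hσ (by linarith)
  refine ⟨c + K * (1 + M) * c, by finiteness, fun V W g G hV hW hg hG hgb hGb hVσ hQ => ?_⟩
  have hVW : AEMeasurable fun x => V x * W x := hV.mul hW
  have hGi : ∫⁻ x, ‖G x‖ₑ ^ 2 ≤ c * ∫⁻ x, V x * W x := by
    rw [← lintegral_const_mul'' _ hVW]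
    exact lintegral_mono_ae hGb
  have hGt : ∫⁻ x, ‖G x‖ₑ ^ 2 ≠ ⊤ := ne_top_of_le_ne_top (by finiteness) hGi
  rw [ENNReal.tsum_add, Summable.tsum_finsetSum fun _ _ => ENNReal.summable,
    tsum_enorm_sq_apply hG hGt, add_mul]
  gcongr
  have hcQ : ∫⁻ x, c * (V x * W x) = c * ∫⁻ x, V x * W x := lintegral_const_mul'' _ hVW
  have := h V (fun x => c * (V x * W x)) (fun x => (g x : ℂ)) hV (hVW.const_mul c)
    (Complex.continuous_ofReal.comp_aestronglyMeasurable hg)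
    (by
      filter_upwards [hgb] with x hx
      rw [enorm_complex_ofReal]
      exact hx.trans_eq (by ring))
    (ne_top_of_le_ne_top hM hVσ) (by rw [hcQ]; finiteness)
  simp_rw [Real.rpow_neg_one] at this
  rw [hcQ] at this
  refine this.trans ?_
  rw [mul_assoc _ c]
  gcongr

theorem exists_lintegral_vec_le_small (d ℓ : ℕ) {σ : ℝ} (hσ : 1 ≤ σ) (hd : d / σ < 2)
    {M : ℝ≥0∞} (hM : M ≠ ⊤) {ε : ℝ≥0∞} (hε : ε ≠ 0) :
    ∃ C : ℝ≥0∞, C ≠ ⊤ ∧ ∀ (V : Torus d → ℝ≥0∞) (w : Torus d → Vec ℓ),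
      AEMeasurable V → AEStronglyMeasurable w → ∫⁻ x, ‖w x‖ₑ ^ 2 ≠ ⊤ → ∫⁻ x, V x ^ σ ≤ M →
      ∫⁻ x, V x * ‖w x‖ₑ ^ 2 ≤
        ε * (∑ i, ∑' k, ENNReal.ofReal (bracketSq k) * ‖fourierFamily w i k‖ₑ ^ 2) +
          C * ∑ i, ∑' k, ‖fourierFamily w i k‖ₑ ^ 2 := by
  obtain ⟨C, hC, h⟩ := exists_lintegral_mul_enorm_sq_le_small d hσ hd hM hε
  refine ⟨C, hC, fun V w hV hw hw2 hVσ => ?_⟩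
  have hm : ∀ i ∈ Finset.univ, AEMeasurable (fun x => V x * ‖w x i‖ₑ ^ 2) := fun i _ => hV.mul
    (((EuclideanSpace.proj (𝕜 := ℝ) i).continuous.comp_aestronglyMeasurable hw).enorm.pow_const 2)
  simp_rw [enorm_sq_eq_sum, Finset.mul_sum]
  rw [lintegral_finsetSum' _ hm, ← Finset.sum_add_distrib]
  refine Finset.sum_le_sum fun i _ => ?_
  have := h V (fun x => (w x i : ℂ)) hV (memLp_two_apply hw hw2 i) hVσ
  simp_rw [enorm_complex_ofReal] at this
  exact this

/-- The energy estimate for the difference of two solutions: if the Fourier coefficients of `w`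
solve `∂ₜ w = μ Δ w + g + div G` with zero initial datum and `g`, `G` are controlled by `V w` and
`V^{1/2} w` with `V ∈ L^∞(L^σ)`, `σ > d/2`, then `w = 0`. -/
theorem eq_zero_of_subcritical {ℓ : ℕ} {σ T m : ℝ} (hσ : 1 ≤ σ) (hd : d / σ < 2) (hm : 0 < m)
    {M c : ℝ≥0∞} (hM : M ≠ ⊤) (hc : c ≠ ⊤) {μ : Fin ℓ → ℝ} (hμ : ∀ i, m ≤ μ i)
    {a : ℝ → FourierFamily d ℓ} {w : ℝ → Torus d → Vec ℓ} {g : Fin ℓ → ℝ → Torus d → ℝ}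
    {G : Fin ℓ → ℝ → Torus d → Vec d} {V : ℝ → Torus d → ℝ≥0∞}
    (hint : ∀ i k, IntegrableOn
      (fun s => evolutionCoeff (μ i) (fun x => w s x i) (g i s) (G i s) k) (Ioo 0 T))
    (ha : ∀ i k, ∀ t ∈ Icc 0 T, a t i k =
      ∫ s in (0 : ℝ)..t, evolutionCoeff (μ i) (fun x => w s x i) (g i s) (G i s) k)
    (haw : ∀ᵐ s ∂volume.restrict (Ioo 0 T), fourierFamily (w s) = a s)
    (hw : ∀ᵐ s ∂volume.restrict (Ioo 0 T), AEStronglyMeasurable (w s))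
    (hg : ∀ᵐ s ∂volume.restrict (Ioo 0 T), ∀ i, AEStronglyMeasurable (g i s))
    (hG : ∀ᵐ s ∂volume.restrict (Ioo 0 T), ∀ i, AEStronglyMeasurable (G i s))
    (hV : ∀ᵐ s ∂volume.restrict (Ioo 0 T), AEMeasurable (V s))
    (hV1 : ∀ s x, 1 ≤ V s x)
    (hgb : ∀ᵐ s ∂volume.restrict (Ioo 0 T), ∀ᵐ x, ∀ i,
      ‖g i s x‖ₑ ^ 2 ≤ c * (V s x * (V s x * ‖w s x‖ₑ ^ 2)))
    (hGb : ∀ᵐ s ∂volume.restrict (Ioo 0 T), ∀ᵐ x, ∀ i,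
      ‖G i s x‖ₑ ^ 2 ≤ c * (V s x * ‖w s x‖ₑ ^ 2))
    (hVσ : ∀ᵐ s ∂volume.restrict (Ioo 0 T), ∫⁻ x, V s x ^ σ ≤ M)
    (hQm : AEMeasurable (fun s => ∫⁻ x, V s x * ‖w s x‖ₑ ^ 2) (volume.restrict (Ioo 0 T)))
    (hQ : ∫⁻ s in Ioo 0 T, ∫⁻ x, V s x * ‖w s x‖ₑ ^ 2 ≠ ⊤)
    (hgm : ∀ i k, AEStronglyMeasurable (fun s => mFourierCoeff (fun x => (g i s x : ℂ)) k)
      (volume.restrict (Ioo 0 T)))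
    (hGm : ∀ i j k, AEStronglyMeasurable (fun s => mFourierCoeff (fun x => (G i s x j : ℂ)) k)
      (volume.restrict (Ioo 0 T))) :
    ∀ t ∈ Icc 0 T, a t = 0 := by
  obtain ⟨K, hK, hN⟩ := exists_tsum_nonlinearity_le d hσ hd hM hc
  set E : ℝ → ℝ≥0∞ := fun t => ∑ i, ∑' k, ‖a t i k‖ₑ ^ 2 with hE
  set H : ℝ → ℝ≥0∞ := fun t => ∑ i, ∑' k, ENNReal.ofReal (bracketSq k) * ‖a t i k‖ₑ ^ 2 with hH
  set Q : ℝ → ℝ≥0∞ := fun s => ∫⁻ x, V s x * ‖w s x‖ₑ ^ 2 with hQdef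
  set R : Fin ℓ → (Fin d → ℤ) → ℝ → ℝ≥0∞ := fun i k s =>
    ∑ j, ‖mFourierCoeff (fun x => (G i s x j : ℂ)) k‖ₑ ^ 2 +
      ENNReal.ofReal (bracketSq k)⁻¹ * ‖mFourierCoeff (fun x => (g i s x : ℂ)) k‖ₑ ^ 2 with hR
  have hRm : ∀ i k, AEMeasurable (R i k) (volume.restrict (Ioo 0 T)) := fun i k =>
    (Finset.aemeasurable_fun_sum _ fun j _ => (hGm i j k).enorm.pow_const 2).add
      (((hgm i k).enorm.pow_const 2).const_mul _)
  have ham : ∀ i k, AEMeasurable (fun s => ‖a s i k‖ₑ ^ 2) (volume.restrict (Ioo 0 T)) := by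
    intro i k
    rcases le_or_gt T 0 with hT | hT
    · simp [Ioo_eq_empty_of_le hT]
    have hcont : ContinuousOn (fun t => ∫ s in (0 : ℝ)..t,
        evolutionCoeff (μ i) (fun x => w s x i) (g i s) (G i s) k) (Icc 0 T) := by
      rw [← uIcc_of_le hT.le]
      apply intervalIntegral.continuousOn_primitive_interval
      rw [uIcc_of_le hT.le, integrableOn_Icc_iff_integrableOn_Ioo]
      exact hint i k
    have h1 : ContinuousOn (fun s => a s i k) (Ioo 0 T) :=
      (hcont.mono Ioo_subset_Icc_self).congr fun s hs => ha i k s ⟨hs.1.le, hs.2.le⟩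
    exact (h1.aestronglyMeasurable measurableSet_Ioo).enorm.pow_const 2
  have hEm : AEMeasurable E (volume.restrict (Ioo 0 T)) :=
    Finset.aemeasurable_fun_sum _ fun i _ => AEMeasurable.tsum fun k => ham i k
  have hHm : AEMeasurable H (volume.restrict (Ioo 0 T)) :=
    Finset.aemeasurable_fun_sum _ fun i _ =>
      AEMeasurable.tsum fun k => (ham i k).const_mul _
  have hQae : ∀ᵐ s ∂volume.restrict (Ioo 0 T), Q s < ⊤ := ae_lt_top' hQm hQ
  have hw2 : ∀ s, ∫⁻ x, ‖w s x‖ₑ ^ 2 ≤ Q s := fun s => lintegral_mono fun x =>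
    le_mul_of_one_le_left zero_le (hV1 s x)
  -- Since `V ≥ 1`, the `L²` energy is dominated by `Q`; this also makes `E` integrable in time for
  -- Grönwall's inequality.
  have hEQ : ∀ᵐ s ∂volume.restrict (Ioo 0 T), E s ≤ Q s := by
    filter_upwards [haw, hw, hQae] with s h1 h2 h3
    simp only [hE, ← h1]
    exact (tsum_enorm_sq_apply h2 (ne_top_of_le_ne_top h3.ne (hw2 s))).le.trans (hw2 s)
  have hRQ : ∀ᵐ s ∂volume.restrict (Ioo 0 T), ∑ i, ∑' k, R i k s ≤ ℓ * (K * Q s) := by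
    filter_upwards [hw, hg, hG, hV, hgb, hGb, hVσ, hQae] with s h1 h2 h3 h4 h5 h6 h7 h8
    calc ∑ i, ∑' k, R i k s ≤ ∑ _i : Fin ℓ, K * Q s := by
          refine Finset.sum_le_sum fun i _ => ?_
          exact hN (V s) (fun x => ‖w s x‖ₑ ^ 2) (g i s) (G i s) h4 (h1.enorm.pow_const 2) (h2 i)
            (h3 i) (h5.mono fun x hx => hx i) (h6.mono fun x hx => hx i) h7 h8.ne
      _ = _ := by simp
  have hrestr : ∀ t ∈ Icc 0 T, volume.restrict (Ioo 0 t) ≤ volume.restrict (Ioo 0 T) :=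
    fun t ht => Measure.restrict_mono (Ioo_subset_Ioo_right ht.2) le_rfl
  set m' : ℝ≥0∞ := ENNReal.ofReal m with hm'
  have hm'0 : m' ≠ 0 := by simpa [hm'] using hm
  have hm't : m' ≠ ⊤ := ENNReal.ofReal_ne_top
  set C₁ : ℝ≥0∞ := ENNReal.ofReal (2 * m) + ENNReal.ofReal m⁻¹ * (ℓ * K) with hC₁
  have hC₁0 : C₁ ≠ 0 := by simp [hC₁, hm]
  have hC₁t : C₁ ≠ ⊤ := by finiteness
  have hmode : ∀ i k, ∀ t ∈ Icc 0 T, ‖a t i k‖ₑ ^ 2 +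
      m' * ∫⁻ s in Ioo 0 t, ENNReal.ofReal (bracketSq k) * ‖a s i k‖ₑ ^ 2 ≤
      ∫⁻ s in Ioo 0 t, (ENNReal.ofReal (2 * m) * ‖a s i k‖ₑ ^ 2 +
        ENNReal.ofReal m⁻¹ * R i k s) := by
    intro i k t ht
    have hbr : 0 ≤ bracketSq k := by linarith [one_le_bracketSq k]
    refine le_trans (le_of_eq ?_) (mode_energy (hint i k) (ha i k)
      (mul_nonneg hm.le hbr) ?_ ht)
    · rw [lintegral_const_mul' _ _ ENNReal.ofReal_ne_top, ENNReal.ofReal_mul hm.le, mul_assoc]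
    · filter_upwards [haw] with s hs
      have h1 : mFourierCoeff (fun x => (w s x i : ℂ)) k = a s i k := by rw [← hs]; rfl
      have := mode_dissipation_le hm (hμ i) k (a s i k) (mFourierCoeff (fun x => (g i s x : ℂ)) k)
        fun j => mFourierCoeff (fun x => (G i s x j : ℂ)) k
      rw [evolutionCoeff, h1]
      refine (ENNReal.ofReal_le_ofReal this).trans (le_of_eq ?_)
      simp only [hR, enorm_sq_eq_ofReal]
      rw [ENNReal.ofReal_add (by positivity) (by positivity),
        ENNReal.ofReal_mul (by positivity) (q := ‖a s i k‖ ^ 2),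
        ENNReal.ofReal_mul (by positivity) (p := m⁻¹),
        ENNReal.ofReal_add (by positivity) (by positivity),
        ENNReal.ofReal_sum_of_nonneg (fun _ _ => by positivity),
        ENNReal.ofReal_mul (inv_nonneg.2 hbr)]
  -- Sum of the mode inequalities, exchanging sums and integrals by Tonelli. At this point `∫H` may
  -- still be infinite.
  have hener : ∀ t ∈ Icc 0 T, E t + m' * ∫⁻ s in Ioo 0 t, H s ≤ C₁ * ∫⁻ s in Ioo 0 t, Q s := by
    intro t ht
    have hle := hrestr t ht
    calc E t + m' * ∫⁻ s in Ioo 0 t, H s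
        = ∑ i, ∑' k, (‖a t i k‖ₑ ^ 2 +
            m' * ∫⁻ s in Ioo 0 t, ENNReal.ofReal (bracketSq k) * ‖a s i k‖ₑ ^ 2) := by
          simp only [hE, hH]
          rw [lintegral_finsetSum' _ fun i _ => (AEMeasurable.tsum fun k =>
            ((ham i k).const_mul _).mono_measure hle), Finset.mul_sum, ← Finset.sum_add_distrib]
          refine Finset.sum_congr rfl fun i _ => ?_
          rw [lintegral_tsum fun k => ((ham i k).const_mul _).mono_measure hle,
            ← ENNReal.tsum_mul_left, ← ENNReal.tsum_add]
      _ ≤ ∑ i, ∑' k, ∫⁻ s in Ioo 0 t, (ENNReal.ofReal (2 * m) * ‖a s i k‖ₑ ^ 2 +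
            ENNReal.ofReal m⁻¹ * R i k s) :=
          Finset.sum_le_sum fun i _ => ENNReal.tsum_le_tsum fun k => hmode i k t ht
      _ = ∫⁻ s in Ioo 0 t, (ENNReal.ofReal (2 * m) * E s +
            ENNReal.ofReal m⁻¹ * ∑ i, ∑' k, R i k s) := by
          have hmeas : ∀ i k, AEMeasurable (fun s => ENNReal.ofReal (2 * m) * ‖a s i k‖ₑ ^ 2 +
              ENNReal.ofReal m⁻¹ * R i k s) (volume.restrict (Ioo 0 t)) := fun i k =>
            (((ham i k).const_mul _).add ((hRm i k).const_mul _)).mono_measure hle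
          simp_rw [← lintegral_tsum (hmeas _)]
          rw [← lintegral_finsetSum' _ fun i _ => AEMeasurable.tsum (hmeas i)]
          refine lintegral_congr fun s => ?_
          simp_rw [ENNReal.tsum_add, Finset.sum_add_distrib, ENNReal.tsum_mul_left,
            ← Finset.mul_sum]
          rfl
      _ ≤ ∫⁻ s in Ioo 0 t, C₁ * Q s := by
          refine lintegral_mono_ae ?_
          filter_upwards [ae_mono hle hEQ, ae_mono hle hRQ] with s h1 h2
          calc _ ≤ ENNReal.ofReal (2 * m) * Q s + ENNReal.ofReal m⁻¹ * (ℓ * (K * Q s)) := by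
                gcongr
            _ = _ := by rw [hC₁]; ring
      _ = _ := lintegral_const_mul' _ _ hC₁t
  have hQt : ∀ t ∈ Icc 0 T, ∫⁻ s in Ioo 0 t, Q s ≠ ⊤ := fun t ht =>
    ne_top_of_le_ne_top hQ (lintegral_mono' (hrestr t ht) le_rfl)
  -- The energy inequality itself shows that `w ∈ L²(H¹)`, so the dissipation may be cancelled
  -- below.
  have hHt : ∀ t ∈ Icc 0 T, m' * ∫⁻ s in Ioo 0 t, H s ≠ ⊤ := fun t ht =>
    ne_top_of_le_ne_top (ENNReal.mul_ne_top hC₁t (hQt t ht)) (le_add_self.trans (hener t ht))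
  -- With `ε = m/C₁` the term `C₁ε∫H` equals the dissipation on the left exactly.
  obtain ⟨C, hC, hsmall⟩ := exists_lintegral_vec_le_small d ℓ hσ hd hM
    (ε := m' / C₁) (ENNReal.div_pos hm'0 hC₁t).ne'
  have hEint : ∀ t ∈ Icc 0 T, E t ≤ C₁ * C * ∫⁻ s in Ioo 0 t, E s := by
    intro t ht
    have hle := hrestr t ht
    have h1 : ∫⁻ s in Ioo 0 t, Q s ≤
        m' / C₁ * (∫⁻ s in Ioo 0 t, H s) + C * ∫⁻ s in Ioo 0 t, E s := by
      rw [← lintegral_const_mul'' _ (hHm.mono_measure hle),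
        ← lintegral_const_mul'' _ (hEm.mono_measure hle),
        ← lintegral_add_left' ((hHm.mono_measure hle).const_mul _)]
      refine lintegral_mono_ae (ae_mono hle ?_)
      filter_upwards [haw, hw, hV, hVσ, hQae] with s h1 h2 h3 h4 h5
      have := hsmall (V s) (w s) h3 h2 (ne_top_of_le_ne_top h5.ne (hw2 s)) h4
      rwa [h1] at this
    have h2 : E t + m' * ∫⁻ s in Ioo 0 t, H s ≤
        C₁ * C * (∫⁻ s in Ioo 0 t, E s) + m' * ∫⁻ s in Ioo 0 t, H s := by
      refine (hener t ht).trans ((mul_le_mul_right h1 C₁).trans (le_of_eq ?_))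
      rw [mul_add, ← mul_assoc, ENNReal.mul_div_cancel hC₁0 hC₁t, add_comm, mul_assoc]
    exact (ENNReal.add_le_add_iff_right (hHt t ht)).1 h2
  intro t ht
  have hT : T ∈ Icc 0 T := ⟨ht.1.trans ht.2, le_rfl⟩
  have h0 := gronwall_lintegral (ENNReal.mul_ne_top hC₁t hC) hEint
    (ne_top_of_le_ne_top hQ (lintegral_mono_ae hEQ)) t ht
  ext i k
  have h1 := (Finset.sum_eq_zero_iff.1 h0) i (Finset.mem_univ i)
  have h2 := ENNReal.tsum_eq_zero.1 h1 k
  simpa using h2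

variable {ℓ : ℕ}

/-! ### Measurability and integrability of the nonlinearities along a solution -/

/-- The space-time measure on `(0,T) × 𝕋^d`. -/
noncomputable abbrev spaceTime (T : ℝ) (d : ℕ) : Measure (ℝ × Torus d) :=
  (volume.restrict (Ioo 0 T)).prod volume

theorem ae_spaceTime_mem (T : ℝ) (d : ℕ) : ∀ᵐ p ∂spaceTime T d, p.1 ∈ Ioo 0 T :=
  Measure.quasiMeasurePreserving_fst.ae (ae_restrict_mem measurableSet_Ioo)

theorem ae_spaceTime_of_ae {T : ℝ} {P : ℝ × Torus d → Prop}
    (h : ∀ᵐ p ∂((volume.restrict (Ioi (0 : ℝ))).prod volume), P p) :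
    ∀ᵐ p ∂spaceTime T d, P p := by
  have h1 : (volume.restrict (Ioo 0 T)) ≪ volume.restrict (Ioi (0 : ℝ)) :=
    Measure.absolutelyContinuous_of_le (Measure.restrict_mono Ioo_subset_Ioi_self le_rfl)
  exact (h1.prod Measure.AbsolutelyContinuous.rfl).ae_le h

/-- The nonlinearity is measurable only for positive times; it is extended measurably to all times
and composed with a measurable representative of `u`. The two agree a.e. because times in `(0,T)`
are positive. -/
theorem aestronglyMeasurable_nemytskii {T : ℝ} {E : Type*} [TopologicalSpace E]
    [MeasurableSpace E] [BorelSpace E] [SecondCountableTopology E]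
    [TopologicalSpace.PseudoMetrizableSpace E] [StandardBorelSpace E] [Nonempty E]
    {f : ℝ → Torus d → Vec ℓ → E}
    (hf : Measurable fun p : Ioi (0 : ℝ) × Torus d × Vec ℓ => f p.1 p.2.1 p.2.2)
    {u : ℝ → Torus d → Vec ℓ}
    (hu : AEStronglyMeasurable (fun p : ℝ × Torus d => u p.1 p.2) (spaceTime T d)) :
    AEStronglyMeasurable (fun p : ℝ × Torus d => f p.1 p.2 (u p.1 p.2)) (spaceTime T d) := by
  have hemb : MeasurableEmbedding
      (Prod.map Subtype.val id : Ioi (0 : ℝ) × Torus d × Vec ℓ → ℝ × Torus d × Vec ℓ) :=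
    (MeasurableEmbedding.subtype_coe measurableSet_Ioi).prodMap MeasurableEmbedding.id
  obtain ⟨f', hf', hff'⟩ := hemb.exists_measurable_extend hf fun _ => inferInstance
  have hmeas : Measurable fun p : ℝ × Torus d => f' (p.1, p.2, hu.mk _ p) :=
    hf'.comp (measurable_fst.prodMk
      (measurable_snd.prodMk hu.stronglyMeasurable_mk.measurable))
  refine ⟨_, hmeas.stronglyMeasurable, ?_⟩
  filter_upwards [ae_spaceTime_mem T d, hu.ae_eq_mk] with p hp hup
  have := congr_fun hff' (⟨p.1, hp.1⟩, p.2, u p.1 p.2)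
  simp only [Function.comp_apply, Prod.map_apply, id] at this
  rw [← this, hup]

theorem ennreal_rpow_le_one_add (x : ℝ≥0∞) {p r : ℝ} (hp : 0 ≤ p) (hpr : p ≤ r) :
    x ^ p ≤ 1 + x ^ r := by
  rcases le_total x 1 with hx | hx
  · exact (ENNReal.rpow_le_one hx hp).trans le_self_add
  · exact (ENNReal.rpow_le_rpow_of_exponent_le hx hpr).trans le_add_self

/-- Hölder in space with `θ = q/ξ`: split `|u|^{q(2-θ)} = (|u|^q)^{1-θ} (|u|^ξ)^θ`. The first factor
is bounded in time, and the second gives `‖u(t)‖_{L^ξ}^q`, which is integrable in time. -/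
theorem MemClass.lintegral_rpow_ne_top {T γ q ξ r : ℝ} {v : ℝ → FourierFamily d ℓ}
    {u : ℝ → Torus d → Vec ℓ} (hu : MemClass T γ q ξ v u) (hq : 0 < q) (hξ : q < ξ) (hr : 0 ≤ r)
    (hrq : r ≤ q * (2 - q / ξ)) : ∫⁻ p, ‖u p.1 p.2‖ₑ ^ r ∂spaceTime T d ≠ ⊤ := by
  have hξ0 : 0 < ξ := hq.trans hξ
  have hl0 : 0 ≤ q / ξ := by positivity
  have hl1 : q / ξ ≤ 1 := (div_le_one hξ0).2 hξ.le
  have hum := hu.measurable.enorm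
  suffices h : ∫⁻ p, ‖u p.1 p.2‖ₑ ^ (q * (2 - q / ξ)) ∂spaceTime T d ≠ ⊤ by
    refine ne_top_of_le_ne_top ?_
      (lintegral_mono fun p => ennreal_rpow_le_one_add ‖u p.1 p.2‖ₑ hr hrq)
    rw [lintegral_add_left measurable_const, lintegral_const]
    finiteness
  rw [lintegral_prod _ (hum.pow_const _)]
  set M := essSup (fun t => eLpNorm (u t) (ENNReal.ofReal q) volume) (volume.restrict (Ioo 0 T))
  have hM : M ≠ ⊤ := hu.sup_bound.ne
  have hbound : ∀ᵐ t ∂volume.restrict (Ioo 0 T),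
      ∫⁻ x, ‖u t x‖ₑ ^ (q * (2 - q / ξ)) ≤
        (M ^ q) ^ (1 - q / ξ) * eLpNorm (u t) (ENNReal.ofReal ξ) volume ^ q := by
    filter_upwards [ae_le_essSup (f := fun t => eLpNorm (u t) (ENNReal.ofReal q) volume),
      hu.measurable.prodMk_left] with t h1 h2
    have e1 : eLpNorm (u t) (ENNReal.ofReal q) volume ^ q = ∫⁻ x, ‖u t x‖ₑ ^ q := by
      rw [eLpNorm_eq_lintegral_rpow_enorm_toReal (by simpa using hq) ENNReal.ofReal_ne_top,
        ENNReal.toReal_ofReal hq.le, ← ENNReal.rpow_mul, one_div_mul_cancel hq.ne',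
        ENNReal.rpow_one]
    have e2 : eLpNorm (u t) (ENNReal.ofReal ξ) volume ^ q =
        (∫⁻ x, ‖u t x‖ₑ ^ ξ) ^ (q / ξ) := by
      rw [eLpNorm_eq_lintegral_rpow_enorm_toReal (by simpa using hξ0) ENNReal.ofReal_ne_top,
        ENNReal.toReal_ofReal hξ0.le, ← ENNReal.rpow_mul, one_div_mul_eq_div]
    calc ∫⁻ x, ‖u t x‖ₑ ^ (q * (2 - q / ξ))
        = ∫⁻ x, (‖u t x‖ₑ ^ q) ^ (1 - q / ξ) * (‖u t x‖ₑ ^ ξ) ^ (q / ξ) := by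
          refine lintegral_congr fun x => ?_
          rw [← ENNReal.rpow_mul, ← ENNReal.rpow_mul, ← ENNReal.rpow_add_of_nonneg _ _
            (mul_nonneg hq.le (by linarith)) (by positivity)]
          congr 1
          field_simp
          ring
      _ ≤ (∫⁻ x, ‖u t x‖ₑ ^ q) ^ (1 - q / ξ) * (∫⁻ x, ‖u t x‖ₑ ^ ξ) ^ (q / ξ) :=
          ENNReal.lintegral_mul_norm_pow_le (h2.enorm.pow_const _) (h2.enorm.pow_const _)
            (by linarith) hl0 (by ring)
      _ ≤ _ := by
          rw [← e1, ← e2]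
          have : 0 ≤ 1 - q / ξ := by linarith
          gcongr
  refine ne_top_of_le_ne_top ?_ (lintegral_mono_ae hbound)
  have hMq : (M ^ q) ^ (1 - q / ξ) ≠ ⊤ :=
    ENNReal.rpow_ne_top_of_nonneg (by linarith) (ENNReal.rpow_ne_top_of_nonneg hq.le hM)
  rw [lintegral_const_mul' _ _ hMq]
  exact ENNReal.mul_ne_top hMq hu.integral_bound.ne

theorem MemClass.exists_lintegral_rpow_le {T γ q ξ : ℝ} {v : ℝ → FourierFamily d ℓ}
    {u : ℝ → Torus d → Vec ℓ} (hu : MemClass T γ q ξ v u) (hq : 0 < q) :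
    ∃ M : ℝ≥0∞, M ≠ ⊤ ∧ ∀ᵐ t ∂volume.restrict (Ioo 0 T), ∫⁻ x, ‖u t x‖ₑ ^ q ≤ M := by
  refine ⟨essSup (fun t => eLpNorm (u t) (ENNReal.ofReal q) volume)
    (volume.restrict (Ioo 0 T)) ^ q, ENNReal.rpow_ne_top_of_nonneg hq.le hu.sup_bound.ne, ?_⟩
  filter_upwards [ae_le_essSup (f := fun t => eLpNorm (u t) (ENNReal.ofReal q) volume)] with t h1
  have e1 : eLpNorm (u t) (ENNReal.ofReal q) volume ^ q = ∫⁻ x, ‖u t x‖ₑ ^ q := by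
    rw [eLpNorm_eq_lintegral_rpow_enorm_toReal (by simpa using hq) ENNReal.ofReal_ne_top,
      ENNReal.toReal_ofReal hq.le, ← ENNReal.rpow_mul, one_div_mul_cancel hq.ne',
      ENNReal.rpow_one]
  rw [← e1]
  gcongr

theorem ofReal_rpow_norm {E : Type*} [SeminormedAddCommGroup E] (y : E) {p : ℝ} (hp : 0 ≤ p) :
    ENNReal.ofReal (‖y‖ ^ p) = ‖y‖ₑ ^ p := by
  rw [← ENNReal.ofReal_rpow_of_nonneg (norm_nonneg _) hp, ofReal_norm]

theorem integrable_of_norm_le_rpow {α E E' : Type*} [MeasurableSpace α] {ν : Measure α}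
    [IsFiniteMeasure ν] [NormedAddCommGroup E] [NormedAddCommGroup E'] {g : α → E} {u : α → E'}
    {C p r : ℝ} (hp : 0 ≤ p) (hpr : p ≤ r) (hg : AEStronglyMeasurable g ν)
    (hgu : ∀ᵐ x ∂ν, ‖g x‖ ≤ C * (1 + ‖u x‖ ^ p)) (hu : ∫⁻ x, ‖u x‖ₑ ^ r ∂ν ≠ ⊤) :
    Integrable g ν := by
  refine ⟨hg, ?_⟩
  rw [hasFiniteIntegral_iff_enorm]
  refine lt_of_le_of_lt (b := ENNReal.ofReal C * ∫⁻ x, (2 + ‖u x‖ₑ ^ r) ∂ν) ?_ ?_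
  · rw [← lintegral_const_mul' _ _ ENNReal.ofReal_ne_top]
    refine lintegral_mono_ae ?_
    filter_upwards [hgu] with x hx
    rw [← ofReal_norm]
    refine (ENNReal.ofReal_le_ofReal hx).trans ?_
    rw [ENNReal.ofReal_mul' (by positivity), ENNReal.ofReal_add zero_le_one (by positivity),
      ofReal_rpow_norm _ hp, ENNReal.ofReal_one]
    refine mul_le_mul_right ?_ _
    calc 1 + ‖u x‖ₑ ^ p ≤ 1 + (1 + ‖u x‖ₑ ^ r) := by
          gcongr
          exact ennreal_rpow_le_one_add _ hp hpr
      _ = _ := by rw [← add_assoc, one_add_one_eq_two]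
  · rw [lintegral_add_left measurable_const, lintegral_const]
    finiteness

theorem integrable_mFourierCoeff {T : ℝ} {ρ : ℝ → Torus d → ℝ}
    (hρ : Integrable (fun p : ℝ × Torus d => ρ p.1 p.2) (spaceTime T d)) (k : Fin d → ℤ) :
    Integrable (fun s => mFourierCoeff (fun x => (ρ s x : ℂ)) k) (volume.restrict (Ioo 0 T)) := by
  simp_rw [mFourierCoeff_eq_integral_mul]
  have h : Integrable (fun p : ℝ × Torus d => mFourier (-k) p.2 * (ρ p.1 p.2 : ℂ))
      (spaceTime T d) :=
    (hρ.ofReal (𝕜 := ℂ)).bdd_mul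
      (((mFourier (-k)).continuous.comp continuous_snd).aestronglyMeasurable)
      (ae_of_all _ fun p => (norm_mFourier_apply (-k) p.2).le)
  exact h.integral_prod_left

theorem integrable_evolutionCoeff {T μ : ℝ} {v f : ℝ → Torus d → ℝ} {F : ℝ → Torus d → Vec d}
    (hv : Integrable (fun p : ℝ × Torus d => v p.1 p.2) (spaceTime T d))
    (hf : Integrable (fun p : ℝ × Torus d => f p.1 p.2) (spaceTime T d))
    (hF : Integrable (fun p : ℝ × Torus d => F p.1 p.2) (spaceTime T d)) (k : Fin d → ℤ) :
    Integrable (fun s => evolutionCoeff μ (v s) (f s) (F s) k) (volume.restrict (Ioo 0 T)) :=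
  (((integrable_mFourierCoeff hv k).const_mul _).add (integrable_mFourierCoeff hf k)).add
    ((integrable_finsetSum _ fun j _ => (integrable_mFourierCoeff
      (ρ := fun s x => F s x j) (integrable_apply hF j) k).const_mul _).const_mul _)

theorem mFourierCoeff_ofReal_sub {f g : Torus d → ℝ} (hf : Integrable f) (hg : Integrable g)
    (k : Fin d → ℤ) : mFourierCoeff (fun x => ((f x - g x : ℝ) : ℂ)) k =
      mFourierCoeff (fun x => (f x : ℂ)) k - mFourierCoeff (fun x => (g x : ℂ)) k := by
  simp_rw [mFourierCoeff_eq_integral_mul]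
  have h1 : Integrable fun x => mFourier (-k) x * (f x : ℂ) :=
    integrable_mFourier_mul (hf.ofReal (𝕜 := ℂ)) (-k)
  have h2 : Integrable fun x => mFourier (-k) x * (g x : ℂ) :=
    integrable_mFourier_mul (hg.ofReal (𝕜 := ℂ)) (-k)
  rw [← integral_sub h1 h2]
  refine integral_congr_ae (ae_of_all _ fun x => ?_)
  simp only [Complex.ofReal_sub, mul_sub]

theorem evolutionCoeff_sub {μ : ℝ} {v v' f f' : Torus d → ℝ} {F F' : Torus d → Vec d}
    (hv : Integrable v) (hv' : Integrable v') (hf : Integrable f) (hf' : Integrable f')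
    (hF : Integrable F) (hF' : Integrable F') (k : Fin d → ℤ) :
    evolutionCoeff μ (fun x => v x - v' x) (fun x => f x - f' x) (fun x => F x - F' x) k =
      evolutionCoeff μ v f F k - evolutionCoeff μ v' f' F' k := by
  simp only [evolutionCoeff, PiLp.sub_apply]
  rw [mFourierCoeff_ofReal_sub hv hv', mFourierCoeff_ofReal_sub hf hf']
  simp_rw [fun j => mFourierCoeff_ofReal_sub (integrable_apply hF j) (integrable_apply hF' j) k,
    mul_sub, Finset.sum_sub_distrib, mul_sub]
  ring

/-- The weak formulation as an integrated evolution equation for each Fourier coefficient. -/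
theorem IsWeakSolution.re_mul_eq {T : ℝ} {μ : Fin ℓ → ℝ} {f : Fin ℓ → ℝ → Torus d → Vec ℓ → ℝ}
    {F : Fin ℓ → ℝ → Torus d → Vec ℓ → Vec d} {v₀ : Torus d → Vec ℓ}
    {v : ℝ → FourierFamily d ℓ} {u : ℝ → Torus d → Vec ℓ} (h : IsWeakSolution T μ f F v₀ v u)
    (hreal : ∀ t ∈ Icc 0 T, ∀ i k, v t i (-k) = star (v t i k))
    (hu : Integrable (fun p : ℝ × Torus d => u p.1 p.2) (spaceTime T d))
    (hf : ∀ i, Integrable (fun p : ℝ × Torus d => f i p.1 p.2 (u p.1 p.2)) (spaceTime T d))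
    (hF : ∀ i, Integrable (fun p : ℝ × Torus d => F i p.1 p.2 (u p.1 p.2)) (spaceTime T d))
    (i : Fin ℓ) (k : Fin d → ℤ) (z : ℂ) {t : ℝ} (ht : t ∈ Icc 0 T) :
    (conj z * v t i k).re = (∫ x, inner ℝ (v₀ x) (trigTest i z k x)) +
      (conj z * ∫ s in (0 : ℝ)..t, evolutionCoeff (μ i) (fun x => u s x i)
        (fun x => f i s x (u s x)) (fun x => F i s x (u s x)) k).re := by
  rw [← pairing_trigTest i z k (hreal t ht i k), h _ (smooth_trigTest i z k) t ht]
  congr 1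
  have hsub : Ioo 0 t ⊆ Ioo 0 T := Ioo_subset_Ioo_right ht.2
  set Φ : ℝ → ℂ := fun s => evolutionCoeff (μ i) (fun x => u s x i)
        (fun x => f i s x (u s x)) (fun x => F i s x (u s x)) k with hΦ
  have hΦi : IntegrableOn Φ (Ioo 0 t) :=
    (integrable_evolutionCoeff (v := fun s x => u s x i) (integrable_apply hu i) (hf i) (hF i)
      k).mono_measure (Measure.restrict_mono hsub le_rfl)
  have hterm : ∀ i', ∫ s in (0 : ℝ)..t, ∫ x,
      (μ i' * u s x i' * laplacian (fun y => trigTest i z k y i') x +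
        f i' s x (u s x) * trigTest i z k x i' -
        inner ℝ (F i' s x (u s x)) (gradient (fun y => trigTest i z k y i') x)) =
      if i' = i then (conj z * ∫ s in (0 : ℝ)..t, Φ s).re else 0 := by
    intro i'
    have hae : ∀ᵐ s ∂volume.restrict (Ioo 0 t), ∫ x,
      (μ i' * u s x i' * laplacian (fun y => trigTest i z k y i') x +
        f i' s x (u s x) * trigTest i z k x i' -
        inner ℝ (F i' s x (u s x)) (gradient (fun y => trigTest i z k y i') x)) =
        if i' = i then (conj z * Φ s).re else 0 := by
      refine ae_restrict_of_ae_restrict_of_subset hsub ?_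
      filter_upwards [hu.prod_right_ae, (hf i').prod_right_ae, (hF i').prod_right_ae]
        with s h1 h2 h3
      rw [integral_trigTest h1 h2 h3]
      split_ifs with hi
      · subst hi
        rfl
      · rfl
    rw [intervalIntegral.integral_of_le ht.1, integral_Ioc_eq_integral_Ioo,
      integral_congr_ae hae]
    split_ifs with hi
    · rw [intervalIntegral.integral_of_le ht.1, integral_Ioc_eq_integral_Ioo,
        ← integral_const_mul]
      exact Complex.reCLM.integral_comp_comm (hΦi.const_mul (conj z))
    · simp
  simp_rw [hterm]
  simp

/-- Both solutions have the same datum term, which cancels. The amplitudes `z = 1` and `z = i` then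
recover the real and imaginary parts of the coefficient. -/
theorem IsWeakSolution.sub_eq_integral {T : ℝ} {μ : Fin ℓ → ℝ}
    {f : Fin ℓ → ℝ → Torus d → Vec ℓ → ℝ} {F : Fin ℓ → ℝ → Torus d → Vec ℓ → Vec d}
    {v₀ : Torus d → Vec ℓ} {v₁ v₂ : ℝ → FourierFamily d ℓ} {u₁ u₂ : ℝ → Torus d → Vec ℓ}
    (h₁ : IsWeakSolution T μ f F v₀ v₁ u₁) (h₂ : IsWeakSolution T μ f F v₀ v₂ u₂)
    (hreal₁ : ∀ t ∈ Icc 0 T, ∀ i k, v₁ t i (-k) = star (v₁ t i k))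
    (hreal₂ : ∀ t ∈ Icc 0 T, ∀ i k, v₂ t i (-k) = star (v₂ t i k))
    (hu₁ : Integrable (fun p : ℝ × Torus d => u₁ p.1 p.2) (spaceTime T d))
    (hu₂ : Integrable (fun p : ℝ × Torus d => u₂ p.1 p.2) (spaceTime T d))
    (hf₁ : ∀ i, Integrable (fun p : ℝ × Torus d => f i p.1 p.2 (u₁ p.1 p.2)) (spaceTime T d))
    (hf₂ : ∀ i, Integrable (fun p : ℝ × Torus d => f i p.1 p.2 (u₂ p.1 p.2)) (spaceTime T d))
    (hF₁ : ∀ i, Integrable (fun p : ℝ × Torus d => F i p.1 p.2 (u₁ p.1 p.2)) (spaceTime T d))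
    (hF₂ : ∀ i, Integrable (fun p : ℝ × Torus d => F i p.1 p.2 (u₂ p.1 p.2)) (spaceTime T d))
    (i : Fin ℓ) (k : Fin d → ℤ) {t : ℝ} (ht : t ∈ Icc 0 T) :
    (v₁ t - v₂ t) i k = ∫ s in (0 : ℝ)..t, evolutionCoeff (μ i) (fun x => (u₁ s x - u₂ s x) i)
        (fun x => f i s x (u₁ s x) - f i s x (u₂ s x))
        (fun x => F i s x (u₁ s x) - F i s x (u₂ s x)) k := by
  have hsub : Ioo 0 t ⊆ Ioo 0 T := Ioo_subset_Ioo_right ht.2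
  have hle : volume.restrict (Ioo 0 t) ≤ volume.restrict (Ioo 0 T) :=
    Measure.restrict_mono hsub le_rfl
  have hi₁ : IntegrableOn (fun s => evolutionCoeff (μ i) (fun x => u₁ s x i)
      (fun x => f i s x (u₁ s x)) (fun x => F i s x (u₁ s x)) k) (Ioo 0 t) :=
    (integrable_evolutionCoeff (v := fun s x => u₁ s x i) (integrable_apply hu₁ i) (hf₁ i)
      (hF₁ i) k).mono_measure hle
  have hi₂ : IntegrableOn (fun s => evolutionCoeff (μ i) (fun x => u₂ s x i)
      (fun x => f i s x (u₂ s x)) (fun x => F i s x (u₂ s x)) k) (Ioo 0 t) :=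
    (integrable_evolutionCoeff (v := fun s x => u₂ s x i) (integrable_apply hu₂ i) (hf₂ i)
      (hF₂ i) k).mono_measure hle
  have hR : ∫ s in (0 : ℝ)..t, evolutionCoeff (μ i) (fun x => (u₁ s x - u₂ s x) i)
        (fun x => f i s x (u₁ s x) - f i s x (u₂ s x))
        (fun x => F i s x (u₁ s x) - F i s x (u₂ s x)) k =
      (∫ s in (0 : ℝ)..t, evolutionCoeff (μ i) (fun x => u₁ s x i)
        (fun x => f i s x (u₁ s x)) (fun x => F i s x (u₁ s x)) k) -
      ∫ s in (0 : ℝ)..t, evolutionCoeff (μ i) (fun x => u₂ s x i)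
        (fun x => f i s x (u₂ s x)) (fun x => F i s x (u₂ s x)) k := by
    simp_rw [intervalIntegral.integral_of_le ht.1, integral_Ioc_eq_integral_Ioo]
    rw [← integral_sub hi₁ hi₂]
    refine integral_congr_ae (ae_mono hle ?_)
    filter_upwards [hu₁.prod_right_ae, hu₂.prod_right_ae, (hf₁ i).prod_right_ae,
      (hf₂ i).prod_right_ae, (hF₁ i).prod_right_ae, (hF₂ i).prod_right_ae]
      with s a1 a2 a3 a4 a5 a6
    exact evolutionCoeff_sub (integrable_apply a1 i) (integrable_apply a2 i) a3 a4 a5 a6 k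
  rw [hR]
  have key : ∀ z : ℂ, (conj z * (v₁ t - v₂ t) i k).re =
      (conj z * ((∫ s in (0 : ℝ)..t, evolutionCoeff (μ i) (fun x => u₁ s x i)
        (fun x => f i s x (u₁ s x)) (fun x => F i s x (u₁ s x)) k) -
      ∫ s in (0 : ℝ)..t, evolutionCoeff (μ i) (fun x => u₂ s x i)
        (fun x => f i s x (u₂ s x)) (fun x => F i s x (u₂ s x)) k)).re := by
    intro z
    simp only [Pi.sub_apply, mul_sub, Complex.sub_re]
    rw [h₁.re_mul_eq hreal₁ hu₁ hf₁ hF₁ i k z ht, h₂.re_mul_eq hreal₂ hu₂ hf₂ hF₂ i k z ht]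
    ring
  apply Complex.ext
  · simpa using key 1
  · simpa using key Complex.I

/-! ### Uniqueness -/

theorem one_add_add_rpow_le {p : ℝ} (hp : 0 ≤ p) (a b : ℝ≥0∞) :
    (1 + a + b) ^ p ≤ 3 ^ p * (1 + a ^ p + b ^ p) := by
  have key : ∀ x : ℝ≥0∞, 1 ≤ x → a ≤ x → b ≤ x → (1 + a + b) ^ p ≤ 3 ^ p * x ^ p := by
    intro x h1 h2 h3
    rw [← ENNReal.mul_rpow_of_nonneg _ _ hp]
    gcongr
    calc 1 + a + b ≤ x + x + x := by gcongr
      _ = 3 * x := by ring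
  rcases le_total a b with hab | hab
  · rcases le_total b 1 with hb | hb
    · exact (key 1 le_rfl (hab.trans hb) hb).trans (by
        gcongr
        rw [ENNReal.one_rpow, add_assoc]
        exact le_self_add)
    · exact (key b hb hab le_rfl).trans (by gcongr; exact le_add_self)
  · rcases le_total a 1 with ha | ha
    · exact (key 1 le_rfl ha (hab.trans ha)).trans (by
        gcongr
        rw [ENNReal.one_rpow, add_assoc]
        exact le_self_add)
    · exact (key a ha le_rfl hab).trans (by
        gcongr
        rw [add_comm 1, add_assoc]
        exact le_self_add)

theorem lintegral_one_add_add_rpow_le {α : Type*} [MeasurableSpace α] {ν : Measure α} {p : ℝ}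
    (hp : 0 ≤ p) {a b : α → ℝ≥0∞} (ha : AEMeasurable a ν) :
    ∫⁻ x, (1 + a x + b x) ^ p ∂ν ≤
      3 ^ p * (ν univ + ∫⁻ x, a x ^ p ∂ν + ∫⁻ x, b x ^ p ∂ν) := by
  refine (lintegral_mono fun x => one_add_add_rpow_le hp (a x) (b x)).trans_eq ?_
  rw [lintegral_const_mul' _ _ (ENNReal.rpow_ne_top_of_nonneg hp (by simp)),
    lintegral_add_left' ((ha.pow_const p).const_add 1), lintegral_add_left measurable_const,
    lintegral_const, one_mul]

/-- The local Lipschitz bound in terms of `1 + |y| + |y'|`. -/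
theorem enorm_sub_sq_le_of_lipschitz {E E' : Type*} [SeminormedAddCommGroup E]
    [SeminormedAddCommGroup E'] {C p : ℝ} (hp : 0 ≤ p) {y y' : E} {b b' : E'}
    (h : ‖b - b'‖ ≤ C * (1 + ‖y‖ ^ p + ‖y'‖ ^ p) * ‖y - y'‖) :
    ‖b - b'‖ₑ ^ 2 ≤ (3 * ENNReal.ofReal C) ^ 2 *
      ((1 + ‖y‖ₑ + ‖y'‖ₑ) ^ (2 * p) * ‖y - y'‖ₑ ^ 2) := by
  have h1 : ‖b - b'‖ₑ ≤ 3 * ENNReal.ofReal C * ((1 + ‖y‖ₑ + ‖y'‖ₑ) ^ p * ‖y - y'‖ₑ) := by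
    rw [← ofReal_norm (b - b')]
    refine (ENNReal.ofReal_le_ofReal h).trans ?_
    rw [ENNReal.ofReal_mul' (norm_nonneg _), ENNReal.ofReal_mul' (by positivity),
      ENNReal.ofReal_add (by positivity) (by positivity),
      ENNReal.ofReal_add (by positivity) (by positivity), ofReal_rpow_norm _ hp,
      ofReal_rpow_norm _ hp, ENNReal.ofReal_one, ofReal_norm]
    set r := 1 + ‖y‖ₑ + ‖y'‖ₑ
    have hr : 1 ≤ r := by simp only [r, add_assoc]; exact le_self_add
    calc ENNReal.ofReal C * (1 + ‖y‖ₑ ^ p + ‖y'‖ₑ ^ p) * ‖y - y'‖ₑ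
        ≤ ENNReal.ofReal C * (r ^ p + r ^ p + r ^ p) * ‖y - y'‖ₑ := by
          gcongr
          · exact (ENNReal.one_rpow p).symm.le.trans (ENNReal.rpow_le_rpow hr hp)
          · exact le_add_self.trans le_self_add
          · exact le_add_self
      _ = _ := by ring
  calc ‖b - b'‖ₑ ^ 2 ≤ (3 * ENNReal.ofReal C * ((1 + ‖y‖ₑ + ‖y'‖ₑ) ^ p * ‖y - y'‖ₑ)) ^ 2 := by
        gcongr
    _ = _ := by
        rw [mul_pow, mul_pow ((1 + ‖y‖ₑ + ‖y'‖ₑ) ^ p), ← ENNReal.rpow_mul_natCast, mul_comm p]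
        norm_cast

/-- The exponent conditions have separate roles: `d(h-1)/2 < q` makes the potential subcritical, `h
- 1 ≤ q` gives `σ ≥ 1`, and `h + 1 ≤ q(2 - q/ξ)` makes `∫∫V|w|²` and the nonlinear terms integrable
on space-time. -/
theorem weakSolution_unique {h q ξ : ℝ} (hh : 1 < h) (hq : d * (h - 1) / 2 < q)
    (hq1 : h - 1 ≤ q) (hξ : q < ξ) (hhq : h + 1 ≤ q * (2 - q / ξ))
    {f : Fin ℓ → ℝ → Torus d → Vec ℓ → ℝ} {F : Fin ℓ → ℝ → Torus d → Vec ℓ → Vec d}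
    (hfF : PolynomialGrowth h f F) {m : ℝ} (hm : 0 < m) {μ : Fin ℓ → ℝ} (hμ : ∀ i, m ≤ μ i)
    {v₀ : Torus d → Vec ℓ} {T γ : ℝ} {v₁ v₂ : ℝ → FourierFamily d ℓ}
    {u₁ u₂ : ℝ → Torus d → Vec ℓ} (hu₁ : MemClass T γ q ξ v₁ u₁) (hu₂ : MemClass T γ q ξ v₂ u₂)
    (hs₁ : IsWeakSolution T μ f F v₀ v₁ u₁) (hs₂ : IsWeakSolution T μ f F v₀ v₂ u₂) :
    (∀ t ∈ Icc 0 T, v₁ t = v₂ t) ∧ ∀ᵐ p ∂spaceTime T d, u₁ p.1 p.2 = u₂ p.1 p.2 := by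
  have hq0 : 0 < q := by linarith
  have hh0 : 0 ≤ h - 1 := by linarith
  have hm₁ := hu₁.measurable
  have hm₂ := hu₂.measurable
  have hL₁ := hu₁.lintegral_rpow_ne_top hq0 hξ (r := h + 1) (by linarith) hhq
  have hL₂ := hu₂.lintegral_rpow_ne_top hq0 hξ (r := h + 1) (by linarith) hhq
  obtain ⟨M₁, hM₁, hMb₁⟩ := hu₁.exists_lintegral_rpow_le hq0
  obtain ⟨M₂, hM₂, hMb₂⟩ := hu₂.exists_lintegral_rpow_le hq0
  obtain ⟨C, hC⟩ := hfF.growth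
  have hC' := ae_spaceTime_of_ae (T := T) hC
  have intu : ∀ {u : ℝ → Torus d → Vec ℓ},
      AEStronglyMeasurable (fun p : ℝ × Torus d => u p.1 p.2) (spaceTime T d) →
      ∫⁻ p, ‖u p.1 p.2‖ₑ ^ (h + 1) ∂spaceTime T d ≠ ⊤ →
      Integrable (fun p : ℝ × Torus d => u p.1 p.2) (spaceTime T d) := fun hu hL =>
    integrable_of_norm_le_rpow (C := 1) (p := 1) zero_le_one (by linarith) hu
      (ae_of_all _ fun p => by
        rw [Real.rpow_one, one_mul]
        exact le_add_of_nonneg_left zero_le_one) hL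
  have intf : ∀ {u : ℝ → Torus d → Vec ℓ},
      AEStronglyMeasurable (fun p : ℝ × Torus d => u p.1 p.2) (spaceTime T d) →
      ∫⁻ p, ‖u p.1 p.2‖ₑ ^ (h + 1) ∂spaceTime T d ≠ ⊤ →
      ∀ i, Integrable (fun p : ℝ × Torus d => f i p.1 p.2 (u p.1 p.2)) (spaceTime T d) :=
    fun hu hL i => integrable_of_norm_le_rpow (p := h) (by linarith) (by linarith)
      (aestronglyMeasurable_nemytskii (hfF.measurable_f i) hu)
      (hC'.mono fun p hp => (hp i _ 0).1) hL
  have intF : ∀ {u : ℝ → Torus d → Vec ℓ},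
      AEStronglyMeasurable (fun p : ℝ × Torus d => u p.1 p.2) (spaceTime T d) →
      ∫⁻ p, ‖u p.1 p.2‖ₑ ^ (h + 1) ∂spaceTime T d ≠ ⊤ →
      ∀ i, Integrable (fun p : ℝ × Torus d => F i p.1 p.2 (u p.1 p.2)) (spaceTime T d) :=
    fun hu hL i => integrable_of_norm_le_rpow (p := (h + 1) / 2) (by linarith) (by linarith)
      (aestronglyMeasurable_nemytskii (hfF.measurable_F i) hu)
      (hC'.mono fun p hp => (hp i _ 0).2.1) hL
  have iu₁ := intu hm₁ hL₁
  have iu₂ := intu hm₂ hL₂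
  have if₁ := intf hm₁ hL₁
  have if₂ := intf hm₂ hL₂
  have iF₁ := intF hm₁ hL₁
  have iF₂ := intF hm₂ hL₂
  set r : ℝ → Torus d → ℝ≥0∞ := fun s x => 1 + ‖u₁ s x‖ₑ + ‖u₂ s x‖ₑ with hr
  have hr1 : ∀ s x, 1 ≤ r s x := fun s x => by
    simp only [hr, add_assoc]
    exact le_self_add
  have hrm : AEMeasurable (fun p : ℝ × Torus d => r p.1 p.2) (spaceTime T d) :=
    (hm₁.enorm.const_add 1).add hm₂.enorm
  -- One potential serves both nonlinearities: the Lipschitz factor of `F` squared is of order `V`,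
  -- that of `f` squared of order `V²`.
  set V : ℝ → Torus d → ℝ≥0∞ := fun s x => r s x ^ (h - 1) with hV
  set w : ℝ → Torus d → Vec ℓ := fun s x => u₁ s x - u₂ s x with hw
  have iw : Integrable (fun p : ℝ × Torus d => w p.1 p.2) (spaceTime T d) := iu₁.sub iu₂
  have ig : ∀ i, Integrable (fun p : ℝ × Torus d => f i p.1 p.2 (u₁ p.1 p.2) -
      f i p.1 p.2 (u₂ p.1 p.2)) (spaceTime T d) := fun i => (if₁ i).sub (if₂ i)
  have iG : ∀ i, Integrable (fun p : ℝ × Torus d => F i p.1 p.2 (u₁ p.1 p.2) -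
      F i p.1 p.2 (u₂ p.1 p.2)) (spaceTime T d) := fun i => (iF₁ i).sub (iF₂ i)
  have hVw : AEMeasurable (fun p : ℝ × Torus d => V p.1 p.2 * ‖w p.1 p.2‖ₑ ^ 2)
      (spaceTime T d) := (hrm.pow_const _).mul (iw.1.enorm.pow_const 2)
  have hwr : ∀ s x, ‖w s x‖ₑ ≤ r s x := fun s x => by
    refine (enorm_sub_le (a := u₁ s x) (b := u₂ s x)).trans ?_
    simp only [hr, add_assoc]
    exact le_add_self
  have hVwr : ∀ s x, V s x * ‖w s x‖ₑ ^ 2 ≤ r s x ^ (h + 1) := fun s x => by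
    calc V s x * ‖w s x‖ₑ ^ 2 ≤ r s x ^ (h - 1) * r s x ^ 2 := by
          gcongr
          exact hwr s x
      _ = r s x ^ (h + 1) := by
          rw [← ENNReal.rpow_natCast, ← ENNReal.rpow_add_of_nonneg _ _ hh0 (by simp)]
          congr 1
          push_cast
          ring
  have hQfin : ∫⁻ p, V p.1 p.2 * ‖w p.1 p.2‖ₑ ^ 2 ∂spaceTime T d ≠ ⊤ := by
    refine ne_top_of_le_ne_top ?_ (lintegral_mono fun p => hVwr p.1 p.2)
    have h3 : (3 : ℝ≥0∞) ^ (h + 1) ≠ ⊤ := ENNReal.rpow_ne_top_of_nonneg (by linarith) (by simp)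
    exact ne_top_of_le_ne_top (by finiteness)
      (lintegral_one_add_add_rpow_le (by linarith) hm₁.enorm)
  have hQfin' : ∫⁻ s in Ioo 0 T, ∫⁻ x, V s x * ‖w s x‖ₑ ^ 2 ≠ ⊤ := by
    rwa [lintegral_prod _ hVw] at hQfin
  -- With `σ = q/(h-1)`, `V^σ = (1 + |u₁| + |u₂|)^q`, which is bounded in `L¹` uniformly in time.
  have hσ : 1 ≤ q / (h - 1) := (one_le_div (by linarith)).2 hq1
  have hdσ : d / (q / (h - 1)) < 2 := by
    rw [div_div_eq_mul_div, div_lt_iff₀ hq0]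
    linarith
  have hrep : ∀ᵐ s ∂volume.restrict (Ioo 0 T), fourierFamily (w s) = v₁ s - v₂ s := by
    filter_upwards [hu₁.represents, hu₂.represents] with s h1 h2
    ext i k
    rw [← h1.2, ← h2.2]
    exact mFourierCoeff_ofReal_sub (integrable_apply h1.1 i) (integrable_apply h2.1 i) k
  have hzero : ∀ t ∈ Icc 0 T, v₁ t - v₂ t = 0 := by
    refine eq_zero_of_subcritical (σ := q / (h - 1)) (M := 3 ^ q * (1 + M₁ + M₂))
      (c := (3 * ENNReal.ofReal C) ^ 2) hσ hdσ hm ?_ (by finiteness) hμ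
      (a := fun t => v₁ t - v₂ t) (w := w)
      (g := fun i s x => f i s x (u₁ s x) - f i s x (u₂ s x))
      (G := fun i s x => F i s x (u₁ s x) - F i s x (u₂ s x)) (V := V) ?_ ?_ hrep
      ?_ ?_ ?_ ?_ ?_ ?_ ?_ ?_ ?_ hQfin' ?_ ?_
    · exact ENNReal.mul_ne_top (ENNReal.rpow_ne_top_of_nonneg hq0.le (by simp)) (by finiteness)
    · exact fun i k => integrable_evolutionCoeff (v := fun s x => w s x i)
        (integrable_apply iw i) (ig i) (iG i) k
    · exact fun i k t ht => hs₁.sub_eq_integral hs₂ (fun t ht => (hu₁.mem_neg t ht).2)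
        (fun t ht => (hu₂.mem_neg t ht).2) iu₁ iu₂ if₁ if₂ iF₁ iF₂ i k ht
    · exact iw.1.prodMk_left
    · exact ae_all_iff.2 fun i => (ig i).1.prodMk_left
    · exact ae_all_iff.2 fun i => (iG i).1.prodMk_left
    · filter_upwards [hm₁.prodMk_left, hm₂.prodMk_left] with s h1 h2
      exact ((h1.enorm.const_add 1).add h2.enorm).pow_const _
    · exact fun s x => (ENNReal.one_rpow (h - 1)).symm.le.trans
        (ENNReal.rpow_le_rpow (hr1 s x) hh0)
    · filter_upwards [Measure.ae_ae_of_ae_prod hC'] with s hs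
      filter_upwards [hs] with x hx i
      refine (enorm_sub_sq_le_of_lipschitz hh0 (hx i (u₁ s x) (u₂ s x)).2.2.1).trans_eq ?_
      rw [two_mul, ENNReal.rpow_add_of_nonneg _ _ hh0 hh0, mul_assoc]
    · filter_upwards [Measure.ae_ae_of_ae_prod hC'] with s hs
      filter_upwards [hs] with x hx i
      refine (enorm_sub_sq_le_of_lipschitz (by linarith)
        (hx i (u₁ s x) (u₂ s x)).2.2.2).trans_eq ?_
      rw [mul_div_cancel₀ _ (two_ne_zero)]
    · filter_upwards [hMb₁, hMb₂, hm₁.prodMk_left] with s h1 h2 h3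
      have e : ∀ x, V s x ^ (q / (h - 1)) = (1 + ‖u₁ s x‖ₑ + ‖u₂ s x‖ₑ) ^ q := fun x => by
        simp only [hV, hr]
        rw [← ENNReal.rpow_mul, mul_div_cancel₀ _ (by linarith)]
      simp_rw [e]
      refine (lintegral_one_add_add_rpow_le hq0.le h3.enorm).trans ?_
      rw [measure_univ]
      gcongr
    · exact hVw.lintegral_prod_right'
    · exact fun i k => (integrable_mFourierCoeff (ρ := fun s x => f i s x (u₁ s x) -
        f i s x (u₂ s x)) (ig i) k).1
    · exact fun i j k => (integrable_mFourierCoeff (ρ := fun s x => (F i s x (u₁ s x) -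
        F i s x (u₂ s x)) j) (integrable_apply (iG i) j) k).1
  refine ⟨fun t ht => sub_eq_zero.1 (hzero t ht), ?_⟩
  -- From paths back to functions: at almost every time all Fourier coefficients of `w` vanish, and
  -- Parseval gives `w = 0`.
  have hw2 : ∀ᵐ s ∂volume.restrict (Ioo 0 T), ∫⁻ x, ‖w s x‖ₑ ^ 2 = 0 := by
    filter_upwards [hrep, iw.1.prodMk_left, ae_lt_top' hVw.lintegral_prod_right' hQfin',
      ae_restrict_mem measurableSet_Ioo] with s h1 h2 h3 h4
    have hle : ∫⁻ x, ‖w s x‖ₑ ^ 2 ≤ ∫⁻ x, V s x * ‖w s x‖ₑ ^ 2 := lintegral_mono fun x =>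
      le_mul_of_one_le_left zero_le ((ENNReal.one_rpow (h - 1)).symm.le.trans
        (ENNReal.rpow_le_rpow (hr1 s x) hh0))
    rw [← tsum_enorm_sq_apply h2 (ne_top_of_le_ne_top h3.ne hle)]
    have h5 : ∀ i k, mFourierCoeff (fun x => (w s x i : ℂ)) k = 0 := fun i k => by
      have := congr_fun (congr_fun h1 i) k
      rw [hzero s ⟨h4.1.le, h4.2.le⟩] at this
      exact this
    simp [h5]
  have hw0 : ∫⁻ p, ‖w p.1 p.2‖ₑ ^ 2 ∂spaceTime T d = 0 := by
    rw [lintegral_prod _ (iw.1.enorm.pow_const 2), lintegral_congr_ae hw2, lintegral_zero]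
  rw [lintegral_eq_zero_iff' (iw.1.enorm.pow_const 2)] at hw0
  filter_upwards [hw0] with p hp
  have : ‖w p.1 p.2‖ₑ ^ 2 = 0 := hp
  exact sub_eq_zero.1 (by simpa using this)

end ReactionDiffusion

/-! ### Admissible exponents and conclusion -/

theorem mainTheorem7 (d : ℕ) (hd : 2 ≤ d) (h q : ℝ) (hh : 1 < h)
    (hq : max ((d : ℝ) * (h - 1) / 2) 2 < q) :
    ∃ ξ₀ : ℝ, q < ξ₀ ∧ ∀ ξ : ℝ,
      ((3 ≤ d ∧ ξ = (d : ℝ) * q / ((d : ℝ) - 2)) ∨ (d = 2 ∧ ξ₀ ≤ ξ)) →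
      ∀ (ℓ : ℕ) (f : Fin ℓ → ℝ → ReactionDiffusion.Torus d → ReactionDiffusion.Vec ℓ → ℝ)
        (F : Fin ℓ → ℝ → ReactionDiffusion.Torus d → ReactionDiffusion.Vec ℓ →
          ReactionDiffusion.Vec d)
        (μ : Fin ℓ → ℝ) (v₀ : ReactionDiffusion.Torus d → ReactionDiffusion.Vec ℓ) (T γ : ℝ)
        (v₁ v₂ : ℝ → ReactionDiffusion.FourierFamily d ℓ)
        (u₁ u₂ : ℝ → ReactionDiffusion.Torus d → ReactionDiffusion.Vec ℓ),
        1 ≤ ℓ → ReactionDiffusion.PolynomialGrowth h f F → ReactionDiffusion.Positivity f F →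
        ReactionDiffusion.MassControl f → (∀ i, 0 < μ i) →
        MemLp v₀ (ENNReal.ofReal q) volume → 0 < T → 0 < γ → γ < 1 →
        ReactionDiffusion.MemClass T γ q ξ v₁ u₁ → ReactionDiffusion.MemClass T γ q ξ v₂ u₂ →
        ReactionDiffusion.IsWeakSolution T μ f F v₀ v₁ u₁ →
        ReactionDiffusion.IsWeakSolution T μ f F v₀ v₂ u₂ →
        (∀ t ∈ Icc 0 T, v₁ t = v₂ t) ∧
          ∀ᵐ p : ℝ × ReactionDiffusion.Torus d ∂((volume.restrict (Ioo 0 T)).prod volume),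
            u₁ p.1 p.2 = u₂ p.1 p.2 := by
  have hq1 : (d : ℝ) * (h - 1) / 2 < q := (le_max_left _ _).trans_lt hq
  have hq2 : 2 < q := (le_max_right _ _).trans_lt hq
  have hd' : (2 : ℝ) ≤ d := by exact_mod_cast hd
  have hhq : h - 1 < q := by nlinarith
  -- Sum of `h - 1 < q` and `2 < q`.
  have hden : 0 < 2 * q - h - 1 := by linarith
  -- For `d = 2`, `h + 1 ≤ 2q - q²/ξ` is equivalent to `ξ ≥ q²/(2q - h - 1)`; the entry `q + 1`
  -- ensures `ξ > q`.
  refine ⟨max (q + 1) (q ^ 2 / (2 * q - h - 1)), lt_max_of_lt_left (by linarith), ?_⟩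
  intro ξ hξ ℓ f F μ v₀ T γ v₁ v₂ u₁ u₂ hℓ hfF _ _ hμ _ _ _ _ hu₁ hu₂ hs₁ hs₂
  have : Nonempty (Fin ℓ) := ⟨⟨0, hℓ⟩⟩
  obtain ⟨i₀, hi₀⟩ := Finite.exists_min μ
  have hξ' : q < ξ ∧ h + 1 ≤ q * (2 - q / ξ) := by
    rcases hξ with ⟨hd3, rfl⟩ | ⟨rfl, hξ⟩
    · have hd3' : (3 : ℝ) ≤ d := by exact_mod_cast hd3
      have hd2 : (0 : ℝ) < d - 2 := by linarith
      refine ⟨?_, ?_⟩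
      · rw [lt_div_iff₀ hd2]
        nlinarith
      · have e : q * (2 - q / (d * q / (d - 2))) = q + 2 * q / d := by
          field_simp
          ring
        have h1 : h - 1 ≤ 2 * q / d := by
          rw [le_div_iff₀ (by linarith)]
          linarith
        rw [e]
        linarith
    · have h1 : q < ξ := by linarith [le_max_left (q + 1) (q ^ 2 / (2 * q - h - 1))]
      have hξ0 : 0 < ξ := by linarith
      refine ⟨h1, ?_⟩
      have h2 : q ^ 2 / (2 * q - h - 1) ≤ ξ := (le_max_right _ _).trans hξ
      rw [div_le_iff₀ hden, mul_comm, ← div_le_iff₀ hξ0] at h2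
      have e : q * (2 - q / ξ) = 2 * q - q ^ 2 / ξ := by ring
      rw [e]
      linarith
  exact ReactionDiffusion.weakSolution_unique hh hq1 hhq.le hξ'.1 hξ'.2 hfF (hμ i₀) hi₀
    hu₁ hu₂ hs₁ hs₂
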